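/- Let $A\subset\mathbb{R}^d$ be a finite set which affinely spans $\mathbb{R}^d$, let $\omega:A\to\mathbb{R}$ be any function, and let $$U=U(A,\omega)=\operatorname{conv}\{(u,\omega(u)) : u\in A\}+\mathbb{R}_{\ge 0}\,e_{d+1}\subset\mathbb{R}^d\times\mathbb{R}=\mathbb{R}^{d+1}$$ be the extended Newton polyhedron. Definitions. The nonempty proper faces of $U$ are its intersections with supporting hyperplanes, and its facets are the maximal ones. A face is *lower* if it has an outward normal vector $h$ with $\langle h,e_{d+1}\rangle<0$. The regular subdivision $\Sigma_\omega(A)$ is the polytopal complex whose cells are the orthogonal projections to $\mathbb{R}^d$ of the (nonempty) lower faces of $U$. The compactified boundary complex $\partial^\bullet U$ has as cells the closures of the proper faces of $U$ in the one-point compactification $\mathbb{R}^{d+1}\cup\{\infty\}$ and, if some proper face is unbounded, the vertex $\{\infty\}$. A total ordering $\sigma_1,\dots,\sigma_m$ of the maximal cells of a finite regular cell complex of dimension $n$ is a *shelling* if $n\le 0$ or if the following holds: (S1) some ordering of the maximal cells of $\partial\sigma_1$ is a shelling; (S2) for $2\le j\le m$ the complex $\partial\sigma_j\cap\bigcup_{k<j}\partial\sigma_k$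 is pure of dimension $\dim\sigma_j-1$ (the empty complex having dimension $-1$); (S3) for $2\le j\le m$ some ordering of the maximal cells of $\partial\sigma_j$ is a shelling in which the maximal cells of $\partial\sigma_j\cap\bigcup_{k<j}\partial\sigma_k$ appear first. A line $L=o'+\mathbb{R}v$ is *generic* if it meets the affine hull of each facet $F$ of $U$ in exactly one point $p_F$, and $p_F\ne p_G$ for facets $F\ne G$. If $o'$ is an interior point of $U$, such a line, if it is not horizontal, orders the facets as follows: traverse $L$ by descending last coordinate, starting at $o'$ and passing through infinity. That is, first come the facets whose points $p_F$ lie below $o'$, by descending last coordinate of $p_F$, and then the facets whose points $p_F$ lie above $o'$, again by descending last coordinate of $p_F$. Proposition. 1. Let $o$ be an interior point of $U$. Every neighbourhood of $e_{d+1}$ contains a vector $v$ such that the line $o+\mathbb{R}v$ is generic. There is a neighbourhood of $(o,e_{d+1})$ such that for all $(o',v)$ in it for which the line $o'+\mathbb{R}v$ is generic (that is, for every generic line obtained from the vertical line $o+\mathbb{R}e_{d+1}$ by a sufficiently small perturbation) the following holds. The closures of the facets of $U$, in the order induced by the line, form a shelling of $\partial^\bullet U$. In this order the lower facets come before all other facets,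 and their projections, in the same order, form a shelling of $\Sigma_\omega(A)$. 2. The first maximal cell can be picked arbitrarily: for every maximal cell $C$ of $\Sigma_\omega(A)$ there is an interior point $o$ of $U$ such that, for every generic line obtained from $o+\mathbb{R}e_{d+1}$ by a sufficiently small perturbation in the above sense, the shellings in 1 begin with the lower facet over $C$ and with $C$, respectively. -/

import Mathlib

open Set Filter Topology
open scoped Pointwise

/-! ### Shellings of finite regular cell complexes

A complex is given by the set `K` of its nonempty closed cells, as subsets of a space `X`, together
with a function `dim` that gives the dimension of each cell. -/

section Shelling

variable {X : Type*}

/-- The maximal cells of a complex. -/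
def maximalCells (K : Set (Set X)) : Set (Set X) := {σ | Maximal (· ∈ K) σ}

/-- The boundary complex `∂σ` of a cell `σ` of `K`: all cells properly contained in `σ`. -/
def boundaryComplex (K : Set (Set X)) (σ : Set X) : Set (Set X) := {τ ∈ K | τ ⊂ σ}

/-- `l` is a total ordering of the maximal cells of `K`. -/
def IsCellOrdering (K : Set (Set X)) (l : List (Set X)) : Prop :=
  l.Nodup ∧ ∀ σ, σ ∈ l ↔ σ ∈ maximalCells K

/-- `K` is pure of dimension `k`; the empty complex has dimension `-1` only. -/
def IsPureOfDim (dim : Set X → ℕ) (K : Set (Set X)) (k : ℤ) : Prop :=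
  (K = ∅ → k = -1) ∧ ∀ τ ∈ maximalCells K, (dim τ : ℤ) = k

/-- The complex `∂σ ∩ ⋃ {∂ρ | ρ ∈ prev}`. -/
def overlapComplex (K : Set (Set X)) (prev : List (Set X)) (σ : Set X) : Set (Set X) :=
  boundaryComplex K σ ∩ ⋃ ρ ∈ prev, boundaryComplex K ρ

/-- The maximal cells of `K` appear first in the list `b`. -/
def AppearFirst (K : Set (Set X)) (b : List (Set X)) : Prop :=
  ∃ b₁ b₂ : List (Set X), b = b₁ ++ b₂ ∧ ∀ τ, τ ∈ b₁ ↔ τ ∈ maximalCells K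

/-- The list `l` is a (not necessarily pure) shelling of the complex `K`.
In `step`, the list `b σ` is an ordering of the maximal cells of `∂σ` which is a shelling; if `σ`
is not the first cell of `l`, then `∂σ ∩ ⋃ ∂ρ` (union over the cells `ρ` before `σ`) is pure of
dimension `dim σ - 1`, and its maximal cells appear first in `b σ`. -/
inductive IsShelling (dim : Set X → ℕ) : Set (Set X) → List (Set X) → Prop
  | zero (K : Set (Set X)) (l : List (Set X)) (ordering : IsCellOrdering K l)
      (dim_zero : ∀ σ ∈ K, dim σ = 0) : IsShelling dim K l
  | step (K : Set (Set X)) (l : List (Set X)) (ordering : IsCellOrdering K l)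
      (b : Set X → List (Set X))
      (shelling : ∀ σ ∈ l, IsShelling dim (boundaryComplex K σ) (b σ))
      (pure : ∀ (prev : List (Set X)) (σ : Set X) (next : List (Set X)),
        l = prev ++ σ :: next → prev ≠ [] →
          IsPureOfDim dim (overlapComplex K prev σ) ((dim σ : ℤ) - 1))
      (first : ∀ (prev : List (Set X)) (σ : Set X) (next : List (Set X)),
        l = prev ++ σ :: next → prev ≠ [] →
          AppearFirst (overlapComplex K prev σ) (b σ)) :
      IsShelling dim K l

end Shelling

/-! ### Polyhedra in `ℝ^d × ℝ` -/

/-- The space `ℝ^{d+1} = ℝ^d × ℝ`; the second component is the last coordinate. -/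
abbrev LiftSpace (d : ℕ) : Type := EuclideanSpace ℝ (Fin d) × ℝ

/-- The last standard basis vector `e_{d+1}`. -/
def lastBasis (d : ℕ) : LiftSpace d := (0, 1)

/-- The dimension of (the affine hull of) a convex set. -/
noncomputable def polyDim {V : Type*} [AddCommGroup V] [Module ℝ V] (C : Set V) : ℕ :=
  Module.finrank ℝ (vectorSpan ℝ C)

/-- The nonempty proper faces of a full-dimensional polyhedron `P`: its intersections with
supporting hyperplanes. Here `h.toExposed P` is the set of points of `P` where the nonzero linear
form `h` (an outward normal) attains its maximum over `P`. -/
def properFaces {d : ℕ} (P : Set (LiftSpace d)) : Set (Set (LiftSpace d)) :=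
  {F | F.Nonempty ∧ ∃ h : LiftSpace d →L[ℝ] ℝ, h ≠ 0 ∧ F = h.toExposed P}

/-- The facets of `P`: its maximal proper faces. -/
def facets {d : ℕ} (P : Set (LiftSpace d)) : Set (Set (LiftSpace d)) :=
  maximalCells (properFaces P)

/-- Lower faces: those with an outward normal `h` such that `⟨h, e_{d+1}⟩ < 0`. -/
def IsLowerFace {d : ℕ} (P F : Set (LiftSpace d)) : Prop :=
  F.Nonempty ∧ ∃ h : LiftSpace d →L[ℝ] ℝ, h (lastBasis d) < 0 ∧ F = h.toExposed P

/-- The closure of a face in the one-point compactification: a bounded face stays as it is, an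
unbounded one receives the point `∞`. -/
def compactifyFace {d : ℕ} (F : Set (LiftSpace d)) : Set (OnePoint (LiftSpace d)) :=
  closure ((fun x : LiftSpace d => (x : OnePoint (LiftSpace d))) '' F)

/-- The compactified boundary complex `∂•P`: the compactified proper faces and, if it lies on one of
these, the vertex `∞`. -/
def compactBoundary {d : ℕ} (P : Set (LiftSpace d)) : Set (Set (OnePoint (LiftSpace d))) :=
  compactifyFace '' properFaces P ∪
    {σ | σ = {OnePoint.infty} ∧ ∃ F ∈ properFaces P, OnePoint.infty ∈ compactifyFace F}

/-- The dimension of a cell of `∂•P`: the point `∞` is ignored, and `{∞}` has dimension `0`. -/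
noncomputable def compactDim {d : ℕ} (σ : Set (OnePoint (LiftSpace d))) : ℕ :=
  polyDim ((fun x : LiftSpace d => (x : OnePoint (LiftSpace d))) ⁻¹' σ)

/-! ### The extended Newton polyhedron and the regular subdivision -/

/-- `U(A, ω) = conv {(u, ω u) | u ∈ A} + ℝ_{≥ 0} e_{d+1}`. -/
def extNewton {d : ℕ} (A : Finset (EuclideanSpace ℝ (Fin d))) (ω : A → ℝ) : Set (LiftSpace d) :=
  convexHull ℝ (range fun u : A => ((u : EuclideanSpace ℝ (Fin d)), ω u)) +
    {x | ∃ t : ℝ, 0 ≤ t ∧ x = t • lastBasis d}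

/-- The orthogonal projection of a subset of `ℝ^d × ℝ` to `ℝ^d`. -/
def projectCell {d : ℕ} (F : Set (LiftSpace d)) : Set (EuclideanSpace ℝ (Fin d)) :=
  Prod.fst '' F

/-- The regular subdivision `Σ_ω(A)`: the projections of the lower faces of `U(A, ω)`. -/
def regularSubdivision {d : ℕ} (A : Finset (EuclideanSpace ℝ (Fin d))) (ω : A → ℝ) :
    Set (Set (EuclideanSpace ℝ (Fin d))) :=
  projectCell '' {F | IsLowerFace (extNewton A ω) F}

/-! ### The order of the facets along a line -/

/-- The line `o + ℝ v`. -/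
def lineThrough {d : ℕ} (o v : LiftSpace d) : Set (LiftSpace d) :=
  range fun t : ℝ => o + t • v

/-- The line `o + ℝ v` meets the affine hull of `F` in the point `p` and nowhere else. -/
def MeetsAt {d : ℕ} (o v : LiftSpace d) (F : Set (LiftSpace d)) (p : LiftSpace d) : Prop :=
  lineThrough o v ∩ (affineSpan ℝ F : Set (LiftSpace d)) = {p}

/-- The line `o + ℝ v` is generic for `P`: it meets the affine hulls of the facets in single points,
and these points are pairwise distinct. -/
def IsGenericLine {d : ℕ} (P : Set (LiftSpace d)) (o v : LiftSpace d) : Prop :=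
  (∀ F ∈ facets P, ∃ p, MeetsAt o v F p) ∧
    ∀ F ∈ facets P, ∀ G ∈ facets P, F ≠ G → ∀ p q, MeetsAt o v F p → MeetsAt o v G q → p ≠ q

/-- `F` precedes `G` on the line `o + ℝ v`, which is traversed by descending last coordinate,
starting at `o` and passing through infinity: the intersection points below `o` come first, by
descending last coordinate, and then those above `o`, by descending last coordinate. -/
def Precedes {d : ℕ} (o v : LiftSpace d) (F G : Set (LiftSpace d)) : Prop :=
  ∃ p q, MeetsAt o v F p ∧ MeetsAt o v G q ∧
    ((p.2 < o.2 ∧ o.2 < q.2) ∨ (q.2 < p.2 ∧ p.2 < o.2) ∨ (o.2 < q.2 ∧ q.2 < p.2))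

/-- `l` lists all facets of `P` in the order induced by the line `o + ℝ v`. -/
def IsLineOrder {d : ℕ} (P : Set (LiftSpace d)) (o v : LiftSpace d)
    (l : List (Set (LiftSpace d))) : Prop :=
  (∀ F, F ∈ l ↔ F ∈ facets P) ∧ l.Pairwise (Precedes o v)

/-! ### Faces of finite vector configurations -/

/-! Everything is homogenized. The cone over U is generated by the finite set S of the vectors (u, ω
u, 1) and the ray (e_{d+1}, 0), and a face is encoded by the subset T of S on which a linear form
nonnegative on S vanishes (`Cuts`). Bounded and unbounded faces and the vertex ∞ are then treated
alike: `slice` and `compactSlice` turn T back into a face, and the lower faces are those T that omit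
the ray.

The core is the Bruggesser–Mani argument for such configurations, `SweepOrder.isShelling`. Let o be
positive on all facet forms c_F, and order the facets by the ratio c_F(v) / c_F(o). The point p_σ =
v - (c_σ(v) / c_σ(o)) o lies in the span of σ, and c_F(p_σ) < 0 holds exactly when F precedes σ.
Hence σ meets the earlier facets in the union of those facets of σ that are visible from p_σ: a
visible facet of σ is cut out by an earlier facet (`exists_ridge_facet`), and a face of σ in an
earlier facet lies in a visible facet of σ (`exists_facet`). A sweep inside σ in a generic direction
near p_σ lists the visible facets first (`exists_sweepOrder`), and induction on the rank shows that
it is a shelling. Initial segments of the order are covered as well.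

For the line o + ℝv the sweep uses (o, 1) and -(v, 0). The ratio `crossing` is the inverse of the
parameter at which the line meets the facet hyperplane, so increasing ratios mean descending from o,
passing through infinity and returning from above. On a vertical line the ratio is negative for
lower facets and zero for the others, so nearby generic lines meet the lower facets first. The
initial segment of lower facets yields the subdivision, because the projection is an isomorphism on
lower faces. If o is close to a relative interior point of a lower facet, the ratio of that facet is
the smallest. -/

section Cone

open Module

variable {V : Type*} [AddCommGroup V] [Module ℝ V]

/-- `f` is nonnegative on `S`, and `T` consists of the vectors of `S` on which it vanishes. -/
def Cuts (S T : Set V) (f : Dual ℝ V) : Prop :=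
  (∀ s ∈ S, 0 ≤ f s) ∧ T = {s ∈ S | f s = 0}

/-- `T` is a facet of the cone over `S`, given by its set of generators. -/
def IsConeFacet (S T : Set V) : Prop :=
  (∃ f, Cuts S T f) ∧ Set.finrank ℝ T + 1 = Set.finrank ℝ S

/-- The nonempty proper faces of the cone over `S`. -/
def coneCells (S : Set V) : Set (Set V) := {T | T.Nonempty ∧ T ≠ S ∧ ∃ f, Cuts S T f}

/-- The dimension of the projectivization of the cone over `T`. -/
noncomputable def coneDim (T : Set V) : ℕ := Set.finrank ℝ T - 1

theorem Cuts.subset {S T : Set V} {f : Dual ℝ V} (h : Cuts S T f) : T ⊆ S := by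
  rw [h.2]; exact sep_subset _ _

theorem Cuts.mem_iff {S T : Set V} {f : Dual ℝ V} (h : Cuts S T f) {s : V} (hs : s ∈ S) :
    s ∈ T ↔ f s = 0 := by
  rw [h.2]; exact ⟨fun h => h.2, fun h => ⟨hs, h⟩⟩

theorem Cuts.eq_zero {S T : Set V} {f : Dual ℝ V} (h : Cuts S T f) {s : V} (hs : s ∈ T) :
    f s = 0 := (h.mem_iff (h.subset hs)).1 hs

theorem Cuts.pos {S T : Set V} {f : Dual ℝ V} (h : Cuts S T f) {s : V} (hs : s ∈ S)
    (hT : s ∉ T) : 0 < f s :=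
  lt_of_le_of_ne (h.1 s hs) fun e => hT ((h.mem_iff hs).2 e.symm)

theorem eq_zero_of_mem_span {T : Set V} {f : Dual ℝ V} (h : ∀ t ∈ T, f t = 0) {x : V}
    (hx : x ∈ Submodule.span ℝ T) : f x = 0 := by
  have : Submodule.span ℝ T ≤ LinearMap.ker f := Submodule.span_le.2 fun t ht => h t ht
  exact this hx

theorem Cuts.eq_zero_of_mem_span {S T : Set V} {f : Dual ℝ V} (h : Cuts S T f) {x : V}
    (hx : x ∈ Submodule.span ℝ T) : f x = 0 :=
  _root_.eq_zero_of_mem_span (fun _ ht => h.eq_zero ht) hx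

theorem Cuts.restrict {S T F : Set V} {f : Dual ℝ V} (h : Cuts S T f) (hF : F ⊆ S) :
    Cuts F (F ∩ T) f := by
  refine ⟨fun s hs => h.1 s (hF hs), ?_⟩
  ext s
  constructor
  · rintro ⟨hs, ht⟩; exact ⟨hs, h.eq_zero ht⟩
  · rintro ⟨hs, ht⟩; exact ⟨hs, (h.mem_iff (hF hs)).2 ht⟩

theorem Cuts.restrict_of_subset {S T F : Set V} {f : Dual ℝ V} (h : Cuts S T f) (hF : F ⊆ S)
    (hT : T ⊆ F) : Cuts F T f := by
  simpa [inter_eq_self_of_subset_right hT] using h.restrict hF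

theorem Cuts.exists_ne {S T : Set V} {f : Dual ℝ V} (h : Cuts S T f) (hT : T ≠ S) :
    ∃ s ∈ S, 0 < f s := by
  obtain ⟨s, hs, hsT⟩ := not_subset.1 fun hh => hT (h.subset.antisymm hh)
  exact ⟨s, hs, h.pos hs hsT⟩

/-- A cut of a face of `S` is induced by a cut of `S`. -/
theorem Cuts.extend {S F G : Set V} {f g : Dual ℝ V} (hS : S.Finite) (hf : Cuts S F f)
    (hg : Cuts F G g) : ∃ N : ℝ, Cuts S G (g + N • f) := by
  -- A large multiple of `f` makes the sum positive on the finitely many generators outside `F`,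
  -- while on `F` it does not change `g`.
  have : ∀ᶠ N : ℝ in atTop, ∀ s ∈ S, 0 < f s → 0 < g s + N * f s := by
    refine (hS.eventually_all).2 fun s _ => ?_
    by_cases h : 0 < f s
    · filter_upwards [eventually_gt_atTop (-g s / f s)] with N hN _
      rw [div_lt_iff₀ h] at hN; linarith
    · exact Eventually.of_forall fun _ h' => absurd h' h
  obtain ⟨N, hN⟩ := this.exists
  have key : ∀ s ∈ S, s ∈ F ∨ 0 < g s + N * f s := fun s hs => by
    by_cases h : s ∈ F
    · exact Or.inl h
    · exact Or.inr (hN s hs (hf.pos hs h))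
  refine ⟨N, fun s hs => ?_, ?_⟩
  · rcases key s hs with h | h
    · simpa [hf.eq_zero h] using hg.1 s h
    · simpa using h.le
  · ext s
    constructor
    · intro h
      have := hg.subset h
      exact ⟨hf.subset this, by simp [hf.eq_zero this, hg.eq_zero h]⟩
    · rintro ⟨hs, h⟩
      rcases key s hs with h' | h'
      · exact (hg.mem_iff h').2 (by simpa [hf.eq_zero h'] using h)
      · simp at h; linarith

theorem IsConeFacet.ne {S G : Set V} (hG : IsConeFacet S G) : G ≠ S := by
  rintro rfl
  exact absurd hG.2 (by omega)

theorem IsConeFacet.subset {S G : Set V} (hG : IsConeFacet S G) : G ⊆ S :=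
  hG.1.choose_spec.subset

theorem finite_facets {S : Set V} (hS : S.Finite) : {F | IsConeFacet S F}.Finite :=
  hS.finite_subsets.subset fun _ hF => IsConeFacet.subset hF

variable [FiniteDimensional ℝ V]

theorem Cuts.finrank_lt {S T : Set V} {f : Dual ℝ V} (h : Cuts S T f) (hT : T ≠ S) :
    Set.finrank ℝ T < Set.finrank ℝ S := by
  refine Submodule.finrank_lt_finrank_of_lt (lt_of_le_of_ne (Submodule.span_mono h.subset) ?_)
  intro he
  obtain ⟨s, hs, hsf⟩ := h.exists_ne hT
  have : s ∈ Submodule.span ℝ T := he ▸ Submodule.subset_span hs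
  exact hsf.ne' (h.eq_zero_of_mem_span this)

/-- Facets are maximal among the proper faces. -/
theorem IsConeFacet.eq_of_subset {S G T : Set V} (hG : IsConeFacet S G) {f : Dual ℝ V}
    (hf : Cuts S T f) (hT : T ≠ S) (hGT : G ⊆ T) : T = G := by
  refine Subset.antisymm (fun t ht => ?_) hGT
  obtain ⟨g, hg⟩ := hG.1
  have h1 := hf.finrank_lt hT
  have h2 : Submodule.span ℝ G = Submodule.span ℝ T :=
    Submodule.eq_of_le_of_finrank_le (Submodule.span_mono hGT) (by
      have := hG.2
      change Set.finrank ℝ T ≤ Set.finrank ℝ G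
      omega)
  have : t ∈ Submodule.span ℝ G := h2 ▸ Submodule.subset_span ht
  exact (hg.mem_iff (hf.subset ht)).2 (hg.eq_zero_of_mem_span this)

theorem IsConeFacet.eq_of_subset_facet {S G T : Set V} (hG : IsConeFacet S G)
    (hT : IsConeFacet S T) (hGT : G ⊆ T) : T = G :=
  hG.eq_of_subset hT.1.choose_spec hT.ne hGT

theorem finrank_insert_le (p : V) (T : Set V) :
    Set.finrank ℝ (insert p T) ≤ Set.finrank ℝ T + 1 := by
  unfold Set.finrank
  rw [Submodule.span_insert]
  have h1 := Submodule.finrank_add_le_finrank_add_finrank (Submodule.span ℝ {p})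
    (Submodule.span ℝ T)
  have h2 : finrank ℝ (Submodule.span ℝ {p}) ≤ 1 := by
    simpa using finrank_span_le_card (R := ℝ) ({p} : Set V)
  omega

/-- A face that is visible from `p` lies in a facet that is visible from `p`. -/
theorem exists_facet {S : Set V} (hS : S.Finite) {p : V} (hp : p ∈ Submodule.span ℝ S)
    {T : Set V} {f : Dual ℝ V} (hf : Cuts S T f) (hfp : f p < 0) :
    ∃ G g, Cuts S G g ∧ IsConeFacet S G ∧ T ⊆ G ∧ g p < 0 := by
  induction hn : (S \ T).ncard using Nat.strong_induction_on generalizing T f with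
  | _ n ih =>
    have hTS : T ≠ S := by
      rintro rfl
      exact hfp.ne (hf.eq_zero_of_mem_span hp)
    by_cases hr : Set.finrank ℝ T + 1 = Set.finrank ℝ S
    · exact ⟨T, f, hf, ⟨⟨f, hf⟩, hr⟩, Subset.rfl, hfp⟩
    have hlt := hf.finrank_lt hTS
    have hle := finrank_insert_le p T
    obtain ⟨s₀, hs₀, hs₀'⟩ : ∃ s ∈ S, s ∉ Submodule.span ℝ (insert p T) := by
      by_contra! hcon
      have : Set.finrank ℝ S ≤ Set.finrank ℝ (insert p T) :=
        Submodule.finrank_mono (Submodule.span_le.2 hcon)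
      omega
    -- The hyperplane of `f` is rotated about the span of `T` and `p`: subtracting multiples of `g`
    -- changes neither the zeros on `T` nor the negative value at `p`. The minimal quotient below is
    -- the largest multiple that keeps the form nonnegative on `S`; there the zero set gains `s₁`.
    obtain ⟨g, hg, hgT, hgp⟩ : ∃ g : Dual ℝ V, 0 < g s₀ ∧ (∀ t ∈ T, g t = 0) ∧ g p = 0 := by
      obtain ⟨g, hg, hker⟩ := Submodule.exists_le_ker_of_notMem hs₀'
      have h1 : ∀ t ∈ T, g t = 0 := fun t ht =>
        hker (Submodule.subset_span (mem_insert_of_mem p ht))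
      have h2 : g p = 0 := hker (Submodule.subset_span (mem_insert p T))
      rcases lt_or_gt_of_ne hg with h | h
      · exact ⟨-g, by simpa using h, fun t ht => by simp [h1 t ht], by simp [h2]⟩
      · exact ⟨g, h, h1, h2⟩
    obtain ⟨s₁, ⟨hs₁, hgs₁⟩, hmin⟩ := Set.exists_min_image {s ∈ S | 0 < g s}
      (fun s => f s / g s) (hS.subset (sep_subset _ _)) ⟨s₀, hs₀, hg⟩
    set t := f s₁ / g s₁
    have ht : 0 ≤ t := div_nonneg (hf.1 s₁ hs₁) hgs₁.le
    have hf' : Cuts S {s ∈ S | (f - t • g) s = 0} (f - t • g) := by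
      refine ⟨fun s hs => ?_, rfl⟩
      simp only [LinearMap.sub_apply, LinearMap.smul_apply, smul_eq_mul, sub_nonneg]
      rcases lt_or_ge 0 (g s) with h | h
      · exact (le_div_iff₀ h).1 (hmin s ⟨hs, h⟩)
      · exact (mul_nonpos_of_nonneg_of_nonpos ht h).trans (hf.1 s hs)
    have hsub : T ⊆ {s ∈ S | (f - t • g) s = 0} := fun s hs =>
      ⟨hf.subset hs, by simp [hf.eq_zero hs, hgT s hs]⟩
    have hs₁mem : s₁ ∈ {s ∈ S | (f - t • g) s = 0} :=
      ⟨hs₁, by simp [t, div_mul_cancel₀ _ hgs₁.ne']⟩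
    have hs₁T : s₁ ∉ T := fun h => hgs₁.ne' (hgT _ h)
    obtain ⟨G, g', h1, h2, h3, h4⟩ := ih _ (by
      rw [← hn]
      refine ncard_lt_ncard ?_ hS.sdiff
      exact ⟨sdiff_subset_sdiff_right hsub, fun h => (h ⟨hs₁, hs₁T⟩).2 hs₁mem⟩) hf'
      (by simpa [hgp] using hfp) rfl
    exact ⟨G, g', h1, h2, hsub.trans h3, h4⟩

/-- Linear forms which vanish on a facet are proportional. -/
theorem IsConeFacet.proportional {S G : Set V} (hG : IsConeFacet S G) {f g : Dual ℝ V}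
    (hg : Cuts S G g) (hf : ∀ t ∈ G, f t = 0) :
    ∃ c : ℝ, ∀ x ∈ Submodule.span ℝ S, f x = c * g x := by
  obtain ⟨s, hs, hgs⟩ := hg.exists_ne hG.ne
  have hspan : Submodule.span ℝ (insert s G) = Submodule.span ℝ S := by
    refine Submodule.eq_of_le_of_finrank_le
      (Submodule.span_mono (insert_subset hs hG.subset)) ?_
    change Set.finrank ℝ S ≤ Set.finrank ℝ (insert s G)
    rw [← hG.2]
    refine Submodule.finrank_lt_finrank_of_lt
      (lt_of_le_of_ne (Submodule.span_mono (subset_insert _ _)) fun h => hgs.ne' ?_)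
    exact hg.eq_zero_of_mem_span (h ▸ Submodule.subset_span (mem_insert _ _))
  refine ⟨f s / g s, fun x hx => ?_⟩
  have : (f - (f s / g s) • g) x = 0 := by
    refine _root_.eq_zero_of_mem_span (T := insert s G) ?_ (hspan ▸ hx)
    rintro t (rfl | ht)
    · simp [div_mul_cancel₀ _ hgs.ne']
    · simp [hf t ht, hg.eq_zero ht]
  simpa [sub_eq_zero] using this

theorem IsConeFacet.proportional_pos {S G : Set V} (hG : IsConeFacet S G) {f g : Dual ℝ V}
    (hf : Cuts S G f) (hg : Cuts S G g) :
    ∃ c > 0, ∀ x ∈ Submodule.span ℝ S, f x = c * g x := by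
  obtain ⟨c, hc⟩ := hG.proportional hg fun t ht => hf.eq_zero ht
  obtain ⟨s, hs, hfs⟩ := hf.exists_ne hG.ne
  refine ⟨c, ?_, hc⟩
  rw [hc s (Submodule.subset_span hs)] at hfs
  exact pos_of_mul_pos_left hfs (hg.1 s hs)

/-- The span of a facet is a hyperplane in the span of the cone. -/
theorem IsConeFacet.mem_span {S G : Set V} (hG : IsConeFacet S G) {f : Dual ℝ V}
    (hf : Cuts S G f) {x : V} (hx : x ∈ Submodule.span ℝ S) (hfx : f x = 0) :
    x ∈ Submodule.span ℝ G := by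
  obtain ⟨s, hs, hfs⟩ := hf.exists_ne hG.ne
  have : Submodule.span ℝ G = Submodule.span ℝ S ⊓ LinearMap.ker f := by
    refine Submodule.eq_of_le_of_finrank_le (le_inf (Submodule.span_mono hG.subset)
      (Submodule.span_le.2 fun t ht => hf.eq_zero ht)) ?_
    have h1 : finrank ℝ (Submodule.span ℝ S ⊓ LinearMap.ker f : Submodule ℝ V) <
        Set.finrank ℝ S :=
      Submodule.finrank_lt_finrank_of_lt (lt_of_le_of_ne inf_le_left fun h => hfs.ne'
        (h.ge (Submodule.subset_span hs)).2)
    have h2 := hG.2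
    change _ ≤ Set.finrank ℝ G
    omega
  rw [this]
  exact ⟨hx, hfx⟩

/-- Every facet `G` of a facet `σ` lies in another facet, which induces `G`. -/
theorem exists_ridge_facet {S σ G : Set V} (hS : S.Finite) {f g : Dual ℝ V} (hf : Cuts S σ f)
    (hG : IsConeFacet σ G) (hg : Cuts σ G g) :
    ∃ F f', Cuts S F f' ∧ IsConeFacet S F ∧ F ≠ σ ∧ G ⊆ F ∧
      ∃ c > 0, ∀ x ∈ Submodule.span ℝ σ, f' x = c * g x := by
  obtain ⟨s, hs, hgs⟩ := hg.exists_ne hG.ne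
  obtain ⟨N, hN⟩ := hf.extend hS hg
  have hsS := hf.subset hs
  -- Visibility from `-s` makes the new form positive at `s ∈ σ`. This excludes `F = σ` and makes
  -- the proportionality factor to `g` positive.
  obtain ⟨F, f', h1, h2, h3, h4⟩ := exists_facet hS (p := -s)
    (Submodule.neg_mem _ (Submodule.subset_span hsS)) hN
    (by simpa [hf.eq_zero hs] using hgs)
  obtain ⟨c, hc⟩ := hG.proportional hg (f := f') fun t ht => h1.eq_zero (h3 ht)
  have hfs : 0 < f' s := by simpa using h4
  refine ⟨F, f', h1, h2, ?_, h3, c, ?_, hc⟩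
  · rintro rfl
    exact hfs.ne' (h1.eq_zero hs)
  · rw [hc s (Submodule.subset_span hs)] at hfs
    exact pos_of_mul_pos_left hfs hgs.le

theorem finrank_pos_of_nonempty {S : Set V} (h0 : (0 : V) ∉ S) (h : S.Nonempty) :
    0 < Set.finrank ℝ S := by
  obtain ⟨s, hs⟩ := h
  have : Nontrivial (Submodule.span ℝ S) :=
    ⟨⟨⟨s, Submodule.subset_span hs⟩, 0, fun e => h0 (by
      have := congrArg Subtype.val e
      simp only [ZeroMemClass.coe_zero] at this
      exact this ▸ hs)⟩⟩
  exact Module.finrank_pos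

end Cone

/-! ### Line sweeps and the Bruggesser–Mani shelling of a cone. -/

section Sweep

open Module

/-- A finite set can be listed by increasing values of an injective function. -/
theorem exists_sorted_list {α : Type*} {s : Set α} (hs : s.Finite) (r : α → ℝ)
    (hr : InjOn r s) : ∃ l : List α, (∀ x, x ∈ l ↔ x ∈ s) ∧ l.Pairwise (fun x y => r x < r y) := by
  induction hn : s.ncard generalizing s with
  | zero =>
    rw [ncard_eq_zero hs] at hn
    exact ⟨[], by simp [hn], List.Pairwise.nil⟩
  | succ n ih =>
    have hne : s.Nonempty := by
      rw [← ncard_pos hs]; omega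
    obtain ⟨m, hm, hmin⟩ := Set.exists_min_image s r hs hne
    obtain ⟨l, hl, hl'⟩ := ih (s := s \ {m}) hs.sdiff (hr.mono sdiff_subset) (by
      rw [ncard_sdiff_singleton_of_mem hm]; omega)
    refine ⟨m :: l, fun x => ?_, List.pairwise_cons.2 ⟨fun x hx => ?_, hl'⟩⟩
    · by_cases h : x = m
      · simp [h, hm]
      · simp [h, hl]
    · have hx' := (hl x).1 hx
      exact lt_of_le_of_ne (hmin x hx'.1) fun e => hx'.2 (hr hx'.1 hm e.symm)

variable {V : Type*} [AddCommGroup V] [Module ℝ V]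

/-- The list `l` contains the nonempty facets of the cone over `S`, in the order in which their
hyperplanes are crossed when travelling from `o` in direction `v` through infinity. -/
structure SweepOrder (S : Set V) (c : Set V → Dual ℝ V) (o v : V) (l : List (Set V)) : Prop where
  cuts : ∀ F, IsConeFacet S F → Cuts S F (c F)
  mem_o : o ∈ Submodule.span ℝ S
  mem_v : v ∈ Submodule.span ℝ S
  pos : ∀ F, IsConeFacet S F → 0 < c F o
  mem : ∀ F, F ∈ l ↔ IsConeFacet S F ∧ F.Nonempty
  sorted : l.Pairwise fun F G => c F v / c F o < c G v / c G o

theorem exists_cuts (S : Set V) :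
    ∃ c : Set V → Dual ℝ V, ∀ F, IsConeFacet S F → Cuts S F (c F) := by
  classical
  exact ⟨fun F => if h : IsConeFacet S F then h.1.choose else 0, fun F h => by
    simpa [h] using h.1.choose_spec⟩

/-- The cells of the cone over `S` which lie in one of the facets listed in `l`. -/
def coneSubcomplex (S : Set V) (l : List (Set V)) : Set (Set V) :=
  {T ∈ coneCells S | ∃ F ∈ l, T ⊆ F}

theorem IsConeFacet.mem_coneCells {S F : Set V} (hF : IsConeFacet S F) (h : F.Nonempty) :
    F ∈ coneCells S := ⟨h, hF.ne, hF.1⟩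

/-- Cuts restrict to faces and, by `Cuts.extend`, extend back. So the boundary of σ depends neither
on `S` nor on `l`, which lets the induction pass from `S` to σ. -/
theorem boundaryComplex_coneSubcomplex {S σ : Set V} (hS : S.Finite) {l : List (Set V)}
    (hσ : σ ∈ l) (hσS : IsConeFacet S σ) :
    boundaryComplex (coneSubcomplex S l) σ = coneCells σ := by
  obtain ⟨f, hf⟩ := hσS.1
  ext T
  constructor
  · rintro ⟨⟨⟨h1, h2, g, hg⟩, -⟩, h3⟩
    exact ⟨h1, h3.ne, g, hg.restrict_of_subset hf.subset h3.subset⟩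
  · rintro ⟨h1, h2, g, hg⟩
    obtain ⟨N, hN⟩ := hf.extend hS hg
    refine ⟨⟨⟨h1, ?_, _, hN⟩, σ, hσ, hg.subset⟩, hg.subset.ssubset_of_ne h2⟩
    rintro rfl
    exact h2 (hg.subset.antisymm hf.subset)

variable [FiniteDimensional ℝ V]

/-- Along the ray each form is a nonconstant affine function of ε with a single zero. All generic
directions are found in this way. -/
theorem eventually_forall_apply_add_smul_ne_zero {V : Type*} [AddCommGroup V] [Module ℝ V]
    {ι : Type*} [Finite ι] (ℓ : ι → Dual ℝ V) {w : V} (hw : ∀ i, ℓ i w ≠ 0) (p : V) :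
    ∀ᶠ ε : ℝ in 𝓝[>] 0, ∀ i, ℓ i (p + ε • w) ≠ 0 := by
  rw [eventually_all]
  intro i
  have h1 : ∀ᶠ ε : ℝ in 𝓝[>] 0, ε ≠ -ℓ i p / ℓ i w := by
    rcases eq_or_ne (-ℓ i p / ℓ i w) 0 with h | h
    · rw [h]
      filter_upwards [self_mem_nhdsWithin] with ε hε using ne_of_gt hε
    · exact nhdsWithin_le_nhds (eventually_ne_nhds h.symm)
  filter_upwards [h1] with ε hε h
  apply hε
  rw [eq_div_iff (hw i)]
  simp only [map_add, map_smul, smul_eq_mul] at h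
  linarith

/-- Near any `p` which lies on no facet hyperplane there are directions which define an order of
the facets, and the facets visible from `p` come first. -/
theorem exists_sweepOrder {S : Set V} (hS : S.Finite) {c : Set V → Dual ℝ V}
    (hc : ∀ F, IsConeFacet S F → Cuts S F (c F)) {p : V} (hp : p ∈ Submodule.span ℝ S)
    (hcp : ∀ F, IsConeFacet S F → c F p ≠ 0) :
    ∃ o v, ∃ l₁ l₂ : List (Set V), SweepOrder S c o v (l₁ ++ l₂) ∧
      ∀ F, F ∈ l₁ ↔ (IsConeFacet S F ∧ F.Nonempty) ∧ c F p < 0 := by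
  have hfin := finite_facets hS
  -- Every facet misses some generator, so its form is positive on the sum of all generators.
  set o : V := ∑ s ∈ hS.toFinset, s with ho
  have hoS : o ∈ Submodule.span ℝ S :=
    Submodule.sum_mem _ fun s hs => Submodule.subset_span (hS.mem_toFinset.1 hs)
  have hpos : ∀ F, IsConeFacet S F → 0 < c F o := fun F hF => by
    obtain ⟨s, hs, hsF⟩ := (hc F hF).exists_ne hF.ne
    rw [ho, map_sum]
    exact Finset.sum_pos' (fun i hi => (hc F hF).1 i (hS.mem_toFinset.1 hi))
      ⟨s, hS.mem_toFinset.2 hs, hsF⟩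
  let ι := {P : Set V × Set V // IsConeFacet S P.1 ∧ IsConeFacet S P.2 ∧ P.1 ≠ P.2}
  have : Finite ι := by
    refine Set.Finite.subset (hfin.prod hfin) ?_
    rintro P ⟨h1, h2, -⟩
    exact ⟨h1, h2⟩
  -- This form vanishes at `v` exactly when `F` and `G` have equal ratios. It is nonzero at any
  -- generator in `F` outside `G`.
  let ℓ : ι → Dual ℝ V := fun P => c P.1.1 o • c P.1.2 - c P.1.2 o • c P.1.1
  obtain ⟨w, hwS, hw⟩ := Module.Dual.exists_forall_mem_ne_zero_of_forall_exists
    (Submodule.span ℝ S) ℓ (by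
      rintro ⟨⟨F, G⟩, hF, hG, hFG⟩
      simp only at hF hG hFG
      obtain ⟨s, hs, hsG⟩ : ∃ s ∈ F, s ∉ G := not_subset.1 fun h =>
        hFG (hF.eq_of_subset_facet hG h).symm
      refine ⟨s, Submodule.subset_span (hF.subset hs), ?_⟩
      have h1 := (hc F hF).eq_zero hs
      have h2 := (hc G hG).pos (hF.subset hs) hsG
      simp [ℓ, h1, h2.ne', (hpos F hF).ne'])
  have hne := eventually_forall_apply_add_smul_ne_zero ℓ hw p
  -- A small perturbation keeps the sign of every `c F p`, so the facets visible from `p` are those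
  -- of negative ratio and come first.
  have hsign : ∀ᶠ ε : ℝ in 𝓝[>] 0, ∀ F ∈ {F | IsConeFacet S F},
      (c F p < 0 → c F (p + ε • w) < 0) ∧ (0 < c F p → 0 < c F (p + ε • w)) := by
    rw [hfin.eventually_all]
    intro F hF
    have hcont : Tendsto (fun ε : ℝ => c F (p + ε • w)) (𝓝[>] 0) (𝓝 (c F p)) := by
      have : Continuous fun ε : ℝ => c F p + ε * c F w := by fun_prop
      simpa using (this.tendsto 0).mono_left (nhdsWithin_le_nhds (s := Ioi 0))
    rcases lt_or_gt_of_ne (hcp F hF) with h | h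
    · filter_upwards [hcont.eventually_lt_const h] with ε hε
      exact ⟨fun _ => hε, fun h' => absurd h' h.not_gt⟩
    · filter_upwards [hcont.eventually_const_lt h] with ε hε
      exact ⟨fun h' => absurd h' h.not_gt, fun _ => hε⟩
  obtain ⟨ε, hε1, hε2⟩ := (hne.and hsign).exists
  set v := p + ε • w
  have hinj : InjOn (fun F => c F v / c F o) {F | IsConeFacet S F} := by
    intro F hF G hG h
    by_contra hFG
    refine hε1 ⟨(F, G), hF, hG, hFG⟩ ?_
    have h' : c F v / c F o = c G v / c G o := h
    rw [div_eq_div_iff (hpos F hF).ne' (hpos G hG).ne'] at h'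
    simp only [ℓ, LinearMap.sub_apply, LinearMap.smul_apply, smul_eq_mul]
    linarith
  obtain ⟨l₁, h1, h1'⟩ := exists_sorted_list
    (s := {F | (IsConeFacet S F ∧ F.Nonempty) ∧ c F p < 0})
    (hfin.subset fun F hF => hF.1.1) _ (hinj.mono fun F hF => hF.1.1)
  obtain ⟨l₂, h2, h2'⟩ := exists_sorted_list
    (s := {F | (IsConeFacet S F ∧ F.Nonempty) ∧ 0 < c F p})
    (hfin.subset fun F hF => hF.1.1) _ (hinj.mono fun F hF => hF.1.1)
  refine ⟨o, v, l₁, l₂, ⟨hc, hoS, ?_, hpos, fun F => ?_, ?_⟩, h1⟩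
  · exact Submodule.add_mem _ hp (Submodule.smul_mem _ _ hwS)
  · rw [List.mem_append, h1, h2]
    constructor
    · rintro (h | h) <;> exact h.1
    · intro h
      exact (lt_or_gt_of_ne (hcp F h.1)).imp (fun h' => ⟨h, h'⟩) (fun h' => ⟨h, h'⟩)
  · refine List.pairwise_append.2 ⟨h1', h2', fun F hF G hG => ?_⟩
    have hF := (h1 F).1 hF
    have hG := (h2 G).1 hG
    have e1 := div_neg_of_neg_of_pos ((hε2 F hF.1.1).1 hF.2) (hpos F hF.1.1)
    have e2 := div_pos ((hε2 G hG.1.1).2 hG.2) (hpos G hG.1.1)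
    exact e1.trans e2

/-- A proper face misses a generator `s` and is therefore visible from `-s`, so `exists_facet`
applies. -/
theorem exists_facet_superset {S T : Set V} (hS : S.Finite) {f : Dual ℝ V} (hf : Cuts S T f)
    (hT : T ≠ S) : ∃ F, IsConeFacet S F ∧ T ⊆ F := by
  obtain ⟨s, hs, hfs⟩ := hf.exists_ne hT
  obtain ⟨G, g, -, h, h', -⟩ := exists_facet hS (p := -s)
    (Submodule.neg_mem _ (Submodule.subset_span hs)) hf (by simpa using hfs)
  exact ⟨G, h, h'⟩

theorem SweepOrder.coneSubcomplex_eq {S : Set V} (hS : S.Finite) {c : Set V → Dual ℝ V}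
    {o v : V} {l : List (Set V)} (h : SweepOrder S c o v l) :
    coneSubcomplex S l = coneCells S := by
  refine (sep_subset _ _).antisymm fun T hT => ⟨hT, ?_⟩
  obtain ⟨f, hf⟩ := hT.2.2
  obtain ⟨F, hF, hTF⟩ := exists_facet_superset hS hf hT.2.1
  exact ⟨F, (h.mem F).2 ⟨hF, hT.1.mono hTF⟩, hTF⟩

theorem maximalCells_coneSubcomplex {S : Set V} {l : List (Set V)}
    (hl : ∀ F ∈ l, IsConeFacet S F ∧ F.Nonempty) (F : Set V) :
    F ∈ l ↔ F ∈ maximalCells (coneSubcomplex S l) := by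
  constructor
  · intro hF
    refine ⟨⟨(hl F hF).1.mem_coneCells (hl F hF).2, F, hF, Subset.rfl⟩, fun T hT hFT => ?_⟩
    obtain ⟨f, hf⟩ := hT.1.2.2
    exact ((hl F hF).1.eq_of_subset hf hT.1.2.1 hFT).subset
  · intro hF
    obtain ⟨G, hG, hFG⟩ := hF.1.2
    have := hF.2 (y := G) ⟨(hl G hG).1.mem_coneCells (hl G hG).2, G, hG, Subset.rfl⟩ hFG
    rwa [hFG.antisymm this]

/-- The Bruggesser–Mani theorem: initial segments of the order of the facets along a line are
shellings of the subcomplexes which they generate. -/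
theorem SweepOrder.isShelling {S : Set V} (hS : S.Finite) (h0 : (0 : V) ∉ S)
    {c : Set V → Dual ℝ V} {o v : V} {l₁ l₂ : List (Set V)}
    (h : SweepOrder S c o v (l₁ ++ l₂)) :
    IsShelling coneDim (coneSubcomplex S l₁) l₁ := by
  classical
  induction hn : Set.finrank ℝ S using Nat.strong_induction_on
    generalizing S c o v l₁ l₂ with
  | _ n ih =>
  have hmem : ∀ F ∈ l₁ ++ l₂, IsConeFacet S F ∧ F.Nonempty := fun F hF => (h.mem F).1 hF
  have hmem₁ : ∀ F ∈ l₁, IsConeFacet S F ∧ F.Nonempty := fun F hF =>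
    hmem F (List.mem_append_left _ hF)
  -- the point in which the line meets the span of `σ`
  let p : Set V → V := fun σ => v - (c σ v / c σ o) • o
  -- The sign of `c F (p σ)` compares the ratios of `F` and σ: visibility from `p σ` becomes
  -- precedence in the sweep.
  have hval : ∀ F σ, IsConeFacet S F →
      c F (p σ) = c F o * (c F v / c F o - c σ v / c σ o) := fun F σ hF => by
    have := (h.pos F hF).ne'
    simp only [p, map_sub, map_smul, smul_eq_mul]
    field_simp
  have hratio : ∀ F ∈ l₁ ++ l₂, ∀ G ∈ l₁ ++ l₂, F ≠ G →
      c F v / c F o ≠ c G v / c G o := by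
    have : Std.Symm fun F G : Set V => c F v / c F o ≠ c G v / c G o := ⟨fun _ _ h => h.symm⟩
    intro F hF G hG hFG
    exact (h.sorted.imp (S := fun F G : Set V => c F v / c F o ≠ c G v / c G o)
      fun hlt => ne_of_lt hlt).forall hF hG hFG
  have hnodup : (l₁ ++ l₂).Nodup := h.sorted.imp fun {F G} hlt e => by
    rw [e] at hlt; exact lt_irrefl _ hlt
  have hpS : ∀ σ, p σ ∈ Submodule.span ℝ S := fun σ =>
    Submodule.sub_mem _ h.mem_v (Submodule.smul_mem _ _ h.mem_o)
  have hpσ : ∀ σ ∈ l₁, p σ ∈ Submodule.span ℝ σ := fun σ hσ =>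
    (hmem₁ σ hσ).1.mem_span (h.cuts σ (hmem₁ σ hσ).1) (hpS σ)
      (by rw [hval σ σ (hmem₁ σ hσ).1]; simp)
  -- A facet `G` of σ is visible from `p σ` inside σ exactly when the neighbouring facet `F` is
  -- visible from `p σ`. Here `F` may lie in `l₂`, which is why the sweep has to list all facets.
  have hridge : ∀ σ ∈ l₁, ∀ G g, IsConeFacet σ G → Cuts σ G g →
      ∃ F ∈ l₁ ++ l₂, F ≠ σ ∧ G ⊆ F ∧ ∃ k > 0, g (p σ) = k * c F (p σ) := by
    intro σ hσ G g hG hg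
    have hσS := (hmem₁ σ hσ).1
    obtain ⟨F, f', h1, h2, h3, h4, k, hk, hk'⟩ :=
      exists_ridge_facet hS (h.cuts σ hσS) hG hg
    obtain ⟨k₂, hk₂, hk₂'⟩ := h2.proportional_pos h1 (h.cuts F h2)
    have hFne : F.Nonempty := by
      have e1 := h2.2
      have e2 := hσS.2
      have e3 := finrank_pos_of_nonempty (fun hh => h0 (hσS.subset hh)) (hmem₁ σ hσ).2
      by_contra hcon
      rw [not_nonempty_iff_eq_empty.1 hcon] at e1
      rw [Set.finrank_empty] at e1
      omega
    refine ⟨F, (h.mem F).2 ⟨h2, hFne⟩, h3, h4, k₂ / k, div_pos hk₂ hk, ?_⟩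
    have e1 := hk' _ (hpσ σ hσ)
    rw [hk₂' _ (hpS σ)] at e1
    field_simp
    linarith
  -- By `hridge` and the distinctness of the ratios, `p σ` lies on no facet hyperplane of σ, so a
  -- sweep of σ starting with the facets visible from `p σ` exists; it is a shelling by induction on
  -- the rank.
  have hind : ∀ σ ∈ l₁, ∃ (c' : Set V → Dual ℝ V) (b₁ b₂ : List (Set V)),
      (∀ G, IsConeFacet σ G → Cuts σ G (c' G)) ∧
      IsShelling coneDim (coneCells σ) (b₁ ++ b₂) ∧
      ∀ G, G ∈ b₁ ↔ (IsConeFacet σ G ∧ G.Nonempty) ∧ c' G (p σ) < 0 := by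
    intro σ hσ
    have hσS := (hmem₁ σ hσ).1
    have hσfin := hS.subset hσS.subset
    obtain ⟨c', hc'⟩ := exists_cuts σ
    have hne : ∀ G, IsConeFacet σ G → c' G (p σ) ≠ 0 := by
      intro G hG hz
      obtain ⟨F, hF, hFσ, -, k, hk, hk'⟩ := hridge σ hσ G _ hG (hc' G hG)
      rw [hz, hval F σ (hmem F hF).1] at hk'
      have := mul_ne_zero hk.ne' (mul_ne_zero (h.pos F (hmem F hF).1).ne'
        (sub_ne_zero.2 (hratio F hF σ (List.mem_append_left _ hσ) hFσ)))
      exact this hk'.symm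
    obtain ⟨o', v', b₁, b₂, hb, hb'⟩ := exists_sweepOrder hσfin hc' (hpσ σ hσ) hne
    refine ⟨c', b₁, b₂, hc', ?_, hb'⟩
    have := ih _ (by rw [← hn]; exact (h.cuts σ hσS).finrank_lt hσS.ne) hσfin
      (fun hh => h0 (hσS.subset hh)) (l₁ := b₁ ++ b₂) (l₂ := []) (by simpa using hb) rfl
    rwa [hb.coneSubcomplex_eq hσfin] at this
  choose! c' b₁ b₂ hc' hb hb' using hind
  have hprev : ∀ prev σ next, l₁ = prev ++ σ :: next → ∀ F ∈ l₁ ++ l₂,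
      (F ∈ prev ↔ c F (p σ) < 0) := by
    rintro prev σ next rfl F hF
    have hs := h.sorted
    rw [List.append_assoc, List.pairwise_append] at hs
    rw [hval F σ (hmem F hF).1, ← neg_pos, ← mul_neg, mul_pos_iff_of_pos_left
      (h.pos F (hmem F hF).1), neg_pos, sub_neg]
    refine ⟨fun hFp => hs.2.2 F hFp σ (by simp), fun hlt => ?_⟩
    by_contra hFp
    have hF' : F = σ ∨ F ∈ next ++ l₂ := by
      simp only [List.mem_append, List.mem_cons] at hF ⊢; tauto
    rcases hF' with rfl | hF'
    · exact lt_irrefl _ hlt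
    · exact lt_asymm hlt ((List.pairwise_cons.1 hs.2.1).1 F hF')
  -- a face of `σ` that lies in an earlier facet lies in a facet of `σ` visible from `p σ`
  have hvis : ∀ prev σ next, l₁ = prev ++ σ :: next → ∀ F ∈ prev, ∀ T ⊆ σ ∩ F,
      ∃ G, (IsConeFacet σ G ∧ T ⊆ G) ∧ c' σ G (p σ) < 0 := by
    intro prev σ next e F hF T hT
    have hσ : σ ∈ l₁ := by simp [e]
    have hFl : F ∈ l₁ ++ l₂ := by simp [e, hF]
    have hσS := (hmem₁ σ hσ).1
    obtain ⟨G, g, h1, h2, h3, h4⟩ := exists_facet (hS.subset hσS.subset) (hpσ σ hσ)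
      ((h.cuts F (hmem F hFl).1).restrict hσS.subset) ((hprev prev σ next e F hFl).1 hF)
    obtain ⟨k, hk, hk'⟩ := h2.proportional_pos (hc' σ hσ G h2) h1
    refine ⟨G, ⟨h2, hT.trans h3⟩, ?_⟩
    rw [hk' _ (hpσ σ hσ)]
    exact mul_neg_of_pos_of_neg hk h4
  have hbd : ∀ σ ∈ l₁, boundaryComplex (coneSubcomplex S l₁) σ = coneCells σ := fun σ hσ =>
    boundaryComplex_coneSubcomplex hS hσ (hmem₁ σ hσ).1
  have hov : ∀ prev σ next, l₁ = prev ++ σ :: next → ∀ T,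
      T ∈ overlapComplex (coneSubcomplex S l₁) prev σ ↔
        T ∈ coneCells σ ∧ ∃ F ∈ prev, T ∈ coneCells F := by
    intro prev σ next e T
    simp only [overlapComplex, mem_inter_iff, hbd σ (by simp [e]), mem_iUnion, exists_prop]
    refine and_congr_right fun _ => exists_congr fun F => and_congr_right fun hF => ?_
    rw [hbd F (by simp [e, hF])]
  have hb₁ov : ∀ prev σ next, l₁ = prev ++ σ :: next → ∀ G ∈ b₁ σ,
      G ∈ overlapComplex (coneSubcomplex S l₁) prev σ := by
    intro prev σ next e G hG
    have hσ : σ ∈ l₁ := by simp [e]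
    obtain ⟨⟨h1, h2⟩, h3⟩ := (hb' σ hσ G).1 hG
    obtain ⟨F, hF, hFσ, hGF, k, hk, hk'⟩ := hridge σ hσ G _ h1 (hc' σ hσ G h1)
    have hFp : F ∈ prev := (hprev prev σ next e F hF).2 <| by
      rw [hk'] at h3
      exact neg_of_mul_neg_right h3 hk.le
    refine (hov prev σ next e G).2 ⟨h1.mem_coneCells h2, F, hFp, ?_⟩
    rw [← hbd F (by simp [e, hFp])]
    have hG' : G ∈ boundaryComplex (coneSubcomplex S l₁) σ := by
      rw [hbd σ hσ]; exact h1.mem_coneCells h2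
    refine ⟨hG'.1, hGF.ssubset_of_ne ?_⟩
    rintro rfl
    have e1 := (hmem G hF).1.2
    have e2 := (hmem₁ σ hσ).1.2
    have e3 := h1.2
    omega
  have hoverlap : ∀ prev σ next, l₁ = prev ++ σ :: next → ∀ G,
      G ∈ maximalCells (overlapComplex (coneSubcomplex S l₁) prev σ) ↔ G ∈ b₁ σ := by
    intro prev σ next e G
    have hσ : σ ∈ l₁ := by simp [e]
    constructor
    · rintro ⟨hG, hmax⟩
      obtain ⟨hG1, F, hF, hG2⟩ := (hov prev σ next e G).1 hG
      obtain ⟨f, hf⟩ := hG1.2.2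
      obtain ⟨f', hf'⟩ := hG2.2.2
      obtain ⟨G', ⟨h1, h2⟩, h3⟩ := hvis prev σ next e F hF G
        (subset_inter hf.subset hf'.subset)
      have hG' : G' ∈ b₁ σ := (hb' σ hσ G').2 ⟨⟨h1, hG1.1.mono h2⟩, h3⟩
      have := hmax (hb₁ov prev σ next e G' hG') h2
      rwa [Subset.antisymm h2 this]
    · intro hG
      refine ⟨hb₁ov prev σ next e G hG, fun T hT hGT => ?_⟩
      obtain ⟨hT1, -⟩ := (hov prev σ next e T).1 hT
      obtain ⟨f, hf⟩ := hT1.2.2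
      exact (((hb' σ hσ G).1 hG).1.1.eq_of_subset hf hT1.2.1 hGT).subset
  refine IsShelling.step _ _ ⟨(List.nodup_append.1 hnodup).1, maximalCells_coneSubcomplex hmem₁⟩
    (fun σ => b₁ σ ++ b₂ σ) (fun σ hσ => ?_) (fun prev σ next e hne => ⟨fun hempty => ?_, ?_⟩)
    (fun prev σ next e _ => ⟨b₁ σ, b₂ σ, rfl, fun G => (hoverlap prev σ next e G).symm⟩)
  · rw [hbd σ hσ]
    exact hb σ hσ
  · have hσ : σ ∈ l₁ := by simp [e]
    obtain ⟨F, hF⟩ := List.exists_mem_of_ne_nil _ hne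
    -- The empty face also lies in a visible facet of σ. If the overlap is empty, that facet must be
    -- empty, so σ has rank 1 and dimension 0, in accordance with dimension -1 for the empty
    -- complex.
    obtain ⟨G, ⟨h1, -⟩, h3⟩ := hvis prev σ next e F hF ∅ (empty_subset _)
    have hGe : G = ∅ := by
      by_contra hcon
      have := hb₁ov prev σ next e G
        ((hb' σ hσ G).2 ⟨⟨h1, nonempty_iff_ne_empty.2 hcon⟩, h3⟩)
      simp [hempty] at this
    have h2 := h1.2
    rw [hGe, Set.finrank_empty] at h2
    simp [coneDim, ← h2]
  · intro G hG
    have hσ : σ ∈ l₁ := by simp [e]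
    obtain ⟨⟨h1, h2⟩, h3⟩ := (hb' σ hσ G).1 ((hoverlap prev σ next e G).1 hG)
    have e1 := h1.2
    have e2 := finrank_pos_of_nonempty
      (fun hh => h0 ((hmem₁ σ hσ).1.subset (h1.subset hh))) h2
    simp only [coneDim]
    omega

end Sweep

/-! ### Shellings under inclusion-preserving and inclusion-reflecting maps of cells. -/

section Transport

variable {X Y : Type*} {K : Set (Set X)} {φ : Set X → Set Y}

theorem injOn_of_subset_iff (hφ : ∀ σ ∈ K, ∀ τ ∈ K, φ σ ⊆ φ τ ↔ σ ⊆ τ) : InjOn φ K :=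
  fun σ hσ τ hτ e => ((hφ σ hσ τ hτ).1 e.subset).antisymm ((hφ τ hτ σ hσ).1 e.symm.subset)

theorem mem_maximalCells_image (hφ : ∀ σ ∈ K, ∀ τ ∈ K, φ σ ⊆ φ τ ↔ σ ⊆ τ) {σ : Set X}
    (hσ : σ ∈ K) : φ σ ∈ maximalCells (φ '' K) ↔ σ ∈ maximalCells K := by
  constructor
  · intro h
    exact ⟨hσ, fun τ hτ hστ => (hφ τ hτ σ hσ).1
      (h.2 (mem_image_of_mem φ hτ) ((hφ σ hσ τ hτ).2 hστ))⟩
  · intro h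
    refine ⟨mem_image_of_mem φ hσ, ?_⟩
    rintro _ ⟨τ, hτ, rfl⟩ hστ
    exact (hφ τ hτ σ hσ).2 (h.2 hτ ((hφ σ hσ τ hτ).1 hστ))

theorem mem_map_iff_maximalCells_image (hφ : ∀ σ ∈ K, ∀ τ ∈ K, φ σ ⊆ φ τ ↔ σ ⊆ τ)
    {l : List (Set X)} (hl : ∀ σ, σ ∈ l ↔ σ ∈ maximalCells K) (τ : Set Y) :
    τ ∈ l.map φ ↔ τ ∈ maximalCells (φ '' K) := by
  rw [List.mem_map]
  constructor
  · rintro ⟨σ, hσ, rfl⟩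
    have := (hl σ).1 hσ
    exact (mem_maximalCells_image hφ this.1).2 this
  · intro h
    obtain ⟨σ, hσ, rfl⟩ := h.1
    exact ⟨σ, (hl σ).2 ((mem_maximalCells_image hφ hσ).1 h), rfl⟩

theorem boundaryComplex_image (hφ : ∀ σ ∈ K, ∀ τ ∈ K, φ σ ⊆ φ τ ↔ σ ⊆ τ) {σ : Set X}
    (hσ : σ ∈ K) : boundaryComplex (φ '' K) (φ σ) = φ '' boundaryComplex K σ := by
  ext τ
  constructor
  · rintro ⟨⟨τ, hτ, rfl⟩, h⟩
    refine ⟨τ, ⟨hτ, (hφ τ hτ σ hσ).1 h.subset, fun h' => h.2 ((hφ σ hσ τ hτ).2 h')⟩, rfl⟩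
  · rintro ⟨τ, ⟨hτ, h⟩, rfl⟩
    exact ⟨mem_image_of_mem φ hτ, (hφ τ hτ σ hσ).2 h.1, fun h' => h.2 ((hφ σ hσ τ hτ).1 h')⟩

theorem overlapComplex_image (hφ : ∀ σ ∈ K, ∀ τ ∈ K, φ σ ⊆ φ τ ↔ σ ⊆ τ) {σ : Set X}
    (hσ : σ ∈ K) {prev : List (Set X)} (hprev : ∀ ρ ∈ prev, ρ ∈ K) :
    overlapComplex (φ '' K) (prev.map φ) (φ σ) = φ '' overlapComplex K prev σ := by
  ext τ
  simp only [overlapComplex, boundaryComplex_image hφ hσ, mem_inter_iff, mem_iUnion, exists_prop,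
    List.mem_map]
  constructor
  · rintro ⟨⟨τ, hτ, rfl⟩, _, ⟨ρ, hρ, rfl⟩, h⟩
    rw [boundaryComplex_image hφ (hprev ρ hρ)] at h
    obtain ⟨τ', hτ', e⟩ := h
    obtain rfl := injOn_of_subset_iff hφ hτ'.1 hτ.1 e
    exact ⟨τ', ⟨hτ, mem_iUnion₂.2 ⟨ρ, hρ, hτ'⟩⟩, rfl⟩
  · rintro ⟨τ, ⟨hτ, h⟩, rfl⟩
    obtain ⟨ρ, hρ, h⟩ := mem_iUnion₂.1 h
    refine ⟨mem_image_of_mem φ hτ, φ ρ, ⟨ρ, hρ, rfl⟩, ?_⟩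
    rw [boundaryComplex_image hφ (hprev ρ hρ)]
    exact mem_image_of_mem φ h

theorem IsCellOrdering.map (hφ : ∀ σ ∈ K, ∀ τ ∈ K, φ σ ⊆ φ τ ↔ σ ⊆ τ) {l : List (Set X)}
    (h : IsCellOrdering K l) : IsCellOrdering (φ '' K) (l.map φ) :=
  ⟨h.1.map_on fun _ hσ _ hτ e => injOn_of_subset_iff hφ ((h.2 _).1 hσ).1 ((h.2 _).1 hτ).1 e,
    mem_map_iff_maximalCells_image hφ h.2⟩

/-- Shellings are transported by isomorphisms of complexes. -/
theorem IsShelling.map {dim : Set X → ℕ} {dim' : Set Y → ℕ} {l : List (Set X)}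
    (h : IsShelling dim K l) (hφ : ∀ σ ∈ K, ∀ τ ∈ K, φ σ ⊆ φ τ ↔ σ ⊆ τ)
    (hdim : ∀ σ ∈ K, dim' (φ σ) = dim σ) : IsShelling dim' (φ '' K) (l.map φ) := by
  induction h with
  | zero K l ordering dim_zero =>
    refine IsShelling.zero _ _ (ordering.map hφ) ?_
    rintro _ ⟨σ, hσ, rfl⟩
    rw [hdim σ hσ, dim_zero σ hσ]
  | step K l ordering b shelling pure first ih =>
    have hlK : ∀ σ ∈ l, σ ∈ K := fun σ hσ => ((ordering.2 σ).1 hσ).1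
    have hinv : ∀ σ ∈ K, Function.invFunOn φ K (φ σ) = σ := fun σ hσ =>
      (injOn_of_subset_iff hφ).leftInvOn_invFunOn hσ
    have hsplit : ∀ (prev : List (Set Y)) (τ : Set Y) (next : List (Set Y)),
        l.map φ = prev ++ τ :: next → prev ≠ [] → ∃ prev₀ σ next₀, l = prev₀ ++ σ :: next₀ ∧
          prev₀ ≠ [] ∧ prev = prev₀.map φ ∧ τ = φ σ := by
      intro prev τ next e hne
      obtain ⟨prev₀, l₂, rfl, e1, e2⟩ := List.map_eq_append_iff.1 e
      obtain ⟨σ, next₀, rfl, e3, -⟩ := List.map_eq_cons_iff.1 e2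
      refine ⟨prev₀, σ, next₀, rfl, ?_, e1.symm, e3.symm⟩
      rintro rfl
      exact hne (by simpa using e1.symm)
    have hsub : ∀ σ prev, overlapComplex K prev σ ⊆ K := fun σ prev τ hτ => hτ.1.1
    -- The boundary orderings are indexed by image cells, so the inverse of `φ` on `K` recovers the
    -- original cell.
    refine IsShelling.step _ _ (ordering.map hφ)
      (fun τ => (b (Function.invFunOn φ K τ)).map φ) ?_ ?_ ?_
    · intro τ hτ
      obtain ⟨σ, hσ, rfl⟩ := List.mem_map.1 hτ
      rw [hinv σ (hlK σ hσ), boundaryComplex_image hφ (hlK σ hσ)]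
      exact ih σ hσ (fun σ hσ τ hτ => hφ σ hσ.1 τ hτ.1) (fun σ hσ => hdim σ hσ.1)
    · intro prev τ next e hne
      obtain ⟨prev₀, σ, next₀, e', hne', rfl, rfl⟩ := hsplit prev τ next e hne
      have hσ : σ ∈ K := hlK σ (by simp [e'])
      rw [overlapComplex_image hφ hσ (fun ρ hρ => hlK ρ (by simp [e', hρ])), hdim σ hσ]
      obtain ⟨h1, h2⟩ := pure prev₀ σ next₀ e' hne'
      refine ⟨fun h => h1 (image_eq_empty.1 h), fun τ hτ => ?_⟩
      obtain ⟨ρ, hρ, rfl⟩ := hτ.1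
      rw [hdim ρ (hsub _ _ hρ)]
      exact h2 ρ ((mem_maximalCells_image
        (fun σ hσ τ hτ => hφ σ (hsub _ _ hσ) τ (hsub _ _ hτ)) hρ).1 hτ)
    · intro prev τ next e hne
      obtain ⟨prev₀, σ, next₀, e', hne', rfl, rfl⟩ := hsplit prev τ next e hne
      have hσ : σ ∈ K := hlK σ (by simp [e'])
      rw [overlapComplex_image hφ hσ (fun ρ hρ => hlK ρ (by simp [e', hρ])), hinv σ hσ]
      obtain ⟨b₁, b₂, e1, e2⟩ := first prev₀ σ next₀ e' hne'
      exact ⟨b₁.map φ, b₂.map φ, by simp [e1], mem_map_iff_maximalCells_image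
        (fun σ hσ τ hτ => hφ σ (hsub _ _ hσ) τ (hsub _ _ hτ)) e2⟩

end Transport

/-! ### Homogenization: configurations in the cone and their slices at height one. -/

section Newton

open Module

variable {d : ℕ}

/-- The vectors `(u, ω u, 1)`, `u ∈ A`, together with `(e_{d+1}, 0)`; they generate the cone over
the extended Newton polyhedron. -/
def newtonConfig (A : Finset (EuclideanSpace ℝ (Fin d))) (ω : A → ℝ) : Set (LiftSpace d × ℝ) :=
  insert (lastBasis d, 0) (range fun u : A => (((u : EuclideanSpace ℝ (Fin d)), ω u), (1 : ℝ)))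

/-- The polyhedron generated by the vectors `(x, 1)` in `T` and, if it lies in `T`, the ray
`(e_{d+1}, 0)`. -/
def slice (T : Set (LiftSpace d × ℝ)) : Set (LiftSpace d) :=
  convexHull ℝ {x | (x, (1 : ℝ)) ∈ T} +
    -- The alternative `t = 0` keeps this summand equal to {0}, rather than empty, when the ray is
    -- not in `T`.
    {x | ∃ t : ℝ, 0 ≤ t ∧ x = t • lastBasis d ∧ (t = 0 ∨ (lastBasis d, (0 : ℝ)) ∈ T)}

/-- The slice, with the point `∞` added if the ray `(e_{d+1}, 0)` lies in `T`. -/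
def compactSlice (T : Set (LiftSpace d × ℝ)) : Set (OnePoint (LiftSpace d)) :=
  (fun x : LiftSpace d => (x : OnePoint (LiftSpace d))) '' slice T ∪
    {z | z = OnePoint.infty ∧ (lastBasis d, (0 : ℝ)) ∈ T}

theorem mem_slice {T : Set (LiftSpace d × ℝ)} {x : LiftSpace d} :
    x ∈ slice T ↔ ∃ y ∈ convexHull ℝ {x | (x, (1 : ℝ)) ∈ T}, ∃ t : ℝ, 0 ≤ t ∧
      (t = 0 ∨ (lastBasis d, (0 : ℝ)) ∈ T) ∧ x = y + t • lastBasis d := by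
  constructor
  · rintro ⟨y, hy, _, ⟨t, ht, rfl, h⟩, rfl⟩
    exact ⟨y, hy, t, ht, h, rfl⟩
  · rintro ⟨y, hy, t, ht, h, rfl⟩
    exact ⟨y, hy, _, ⟨t, ht, rfl, h⟩, rfl⟩

theorem mem_slice_of_mem {T : Set (LiftSpace d × ℝ)} {x : LiftSpace d} (hx : (x, (1 : ℝ)) ∈ T) :
    x ∈ slice T :=
  mem_slice.2 ⟨x, subset_convexHull ℝ _ hx, 0, le_rfl, Or.inl rfl, by simp⟩

theorem slice_nonempty_iff {T : Set (LiftSpace d × ℝ)} :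
    (slice T).Nonempty ↔ ∃ x, (x, (1 : ℝ)) ∈ T := by
  constructor
  · rintro ⟨x, hx⟩
    obtain ⟨y, hy, -⟩ := mem_slice.1 hx
    exact convexHull_nonempty_iff.1 ⟨y, hy⟩
  · rintro ⟨x, hx⟩
    exact ⟨x, mem_slice_of_mem hx⟩

theorem slice_mono {T T' : Set (LiftSpace d × ℝ)} (h : T ⊆ T') : slice T ⊆ slice T' := by
  intro x hx
  obtain ⟨y, hy, t, ht, h', rfl⟩ := mem_slice.1 hx
  have hsub : {x | (x, (1 : ℝ)) ∈ T} ⊆ {x | (x, (1 : ℝ)) ∈ T'} := fun z hz => h hz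
  exact mem_slice.2 ⟨y, convexHull_mono hsub hy, t, ht, h'.imp id (fun k => h k), rfl⟩

theorem add_smul_mem_slice {T : Set (LiftSpace d × ℝ)} (h : (lastBasis d, (0 : ℝ)) ∈ T)
    {x : LiftSpace d} (hx : x ∈ slice T) {t : ℝ} (ht : 0 ≤ t) : x + t • lastBasis d ∈ slice T := by
  obtain ⟨y, hy, s, hs, -, rfl⟩ := mem_slice.1 hx
  exact mem_slice.2 ⟨y, hy, s + t, add_nonneg hs ht, Or.inr h, by rw [add_smul, add_assoc]⟩

theorem apply_mk_one (f : Dual ℝ (LiftSpace d × ℝ)) (x y : LiftSpace d) (t : ℝ) :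
    f (x + t • y, 1) = f (x, 1) + t * f (y, 0) := by
  rw [← smul_eq_mul, ← map_smul, ← map_add]
  simp

theorem convex_preimage_dual (f : Dual ℝ (LiftSpace d × ℝ)) {a b : ℝ} (hab : a + b = 1)
    (x y : LiftSpace d) : f (a • x + b • y, 1) = a * f (x, 1) + b * f (y, 1) := by
  rw [← smul_eq_mul, ← smul_eq_mul, ← map_smul, ← map_smul, ← map_add]
  simp [hab]

theorem mem_span_of_mem_slice {T : Set (LiftSpace d × ℝ)} {x : LiftSpace d} (hx : x ∈ slice T) :
    (x, (1 : ℝ)) ∈ Submodule.span ℝ T := by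
  obtain ⟨y, hy, t, ht, h, rfl⟩ := mem_slice.1 hx
  have h1 : convexHull ℝ {x | (x, (1 : ℝ)) ∈ T} ⊆
      {x | (x, (1 : ℝ)) ∈ Submodule.span ℝ T} := by
    refine convexHull_min (fun x hx => Submodule.subset_span hx) ?_
    intro x hx y hy a b _ _ hab
    rw [mem_ofPred_eq] at hx hy
    have := Submodule.add_mem _ (Submodule.smul_mem _ a hx) (Submodule.smul_mem _ b hy)
    simpa [hab] using this
  have h2 : (t • lastBasis d, (0 : ℝ)) ∈ Submodule.span ℝ T := by
    rcases h with rfl | h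
    · simp [← Prod.zero_eq_mk]
    · simpa using Submodule.smul_mem _ t (Submodule.subset_span h)
  simpa using Submodule.add_mem _ (h1 hy) h2

theorem finrank_map_of_forall_eq_zero {V W : Type*} [AddCommGroup V] [Module ℝ V]
    [AddCommGroup W] [Module ℝ W] (f : V →ₗ[ℝ] W) (p : Submodule ℝ V)
    (h : ∀ x ∈ p, f x = 0 → x = 0) : finrank ℝ (p.map f) = finrank ℝ p := by
  rw [← LinearMap.range_domRestrict, LinearMap.finrank_range_of_inj]
  rw [injective_iff_map_eq_zero]
  rintro ⟨x, hx⟩ hx0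
  exact Subtype.ext (h x hx hx0)

/-- The span splits into a line through one point at height one and the directions of the slice at
height zero. Both the dimension shift by one and the description of affine spans come from this. -/
theorem span_eq_sup {T : Set (LiftSpace d × ℝ)} (hT : ∀ p ∈ T, p.2 = 1 ∨ p = (lastBasis d, 0))
    {x₀ : LiftSpace d} (hx₀ : (x₀, (1 : ℝ)) ∈ T) :
    Submodule.span ℝ T = Submodule.span ℝ {(x₀, (1 : ℝ))} ⊔
      (vectorSpan ℝ (slice T)).map (LinearMap.inl ℝ (LiftSpace d) ℝ) := by
  have hx₀' := mem_slice_of_mem hx₀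
  apply le_antisymm
  · rw [Submodule.span_le]
    intro p hp
    rcases hT p hp with h | rfl
    · obtain ⟨x, s⟩ := p
      obtain rfl : s = 1 := h
      refine Submodule.mem_sup.2 ⟨_, Submodule.mem_span_singleton_self _, (x - x₀, 0), ?_, by simp⟩
      exact ⟨x - x₀, vsub_mem_vectorSpan ℝ (mem_slice_of_mem hp) hx₀', rfl⟩
    · refine Submodule.mem_sup_right ⟨lastBasis d, ?_, rfl⟩
      have := vsub_mem_vectorSpan ℝ (add_smul_mem_slice hp hx₀' zero_le_one) hx₀'
      simpa using this
  · refine sup_le (Submodule.span_mono (singleton_subset_iff.2 hx₀)) ?_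
    rw [vectorSpan, Submodule.map_span, Submodule.span_le]
    rintro _ ⟨_, ⟨x, hx, y, hy, rfl⟩, rfl⟩
    simpa using Submodule.sub_mem _ (mem_span_of_mem_slice hx) (mem_span_of_mem_slice hy)

theorem finrank_eq_polyDim_slice_add_one {T : Set (LiftSpace d × ℝ)}
    (hT : ∀ p ∈ T, p.2 = 1 ∨ p = (lastBasis d, 0)) {x₀ : LiftSpace d}
    (hx₀ : (x₀, (1 : ℝ)) ∈ T) : Set.finrank ℝ T = polyDim (slice T) + 1 := by
  have hinf : Submodule.span ℝ {(x₀, (1 : ℝ))} ⊓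
      (vectorSpan ℝ (slice T)).map (LinearMap.inl ℝ (LiftSpace d) ℝ) = ⊥ := by
    rw [eq_bot_iff]
    rintro _ ⟨h1, w, -, rfl⟩
    obtain ⟨c, hc⟩ := Submodule.mem_span_singleton.1 h1
    have hc0 : c = 0 := by simpa using congrArg Prod.snd hc
    rw [← hc, hc0]
    simp
  have := Submodule.finrank_sup_add_finrank_inf_eq (Submodule.span ℝ {(x₀, (1 : ℝ))})
    ((vectorSpan ℝ (slice T)).map (LinearMap.inl ℝ (LiftSpace d) ℝ))
  rw [hinf, ← span_eq_sup hT hx₀, finrank_bot, finrank_span_singleton (by simp),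
    finrank_map_of_forall_eq_zero _ _ fun x _ hx => by simpa using hx] at this
  unfold Set.finrank polyDim
  omega

theorem mem_affineSpan_slice {T : Set (LiftSpace d × ℝ)}
    (hT : ∀ p ∈ T, p.2 = 1 ∨ p = (lastBasis d, 0)) {x₀ : LiftSpace d} (hx₀ : (x₀, (1 : ℝ)) ∈ T)
    {x : LiftSpace d} (hx : (x, (1 : ℝ)) ∈ Submodule.span ℝ T) :
    x ∈ affineSpan ℝ (slice T) := by
  rw [span_eq_sup hT hx₀] at hx
  obtain ⟨_, h1, _, ⟨w, hw, rfl⟩, h⟩ := Submodule.mem_sup.1 hx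
  obtain ⟨c, rfl⟩ := Submodule.mem_span_singleton.1 h1
  obtain rfl : c = 1 := by simpa using congrArg Prod.snd h
  have e : x = w +ᵥ x₀ := by
    have := congrArg Prod.fst h
    simp at this
    simp [← this, add_comm]
  rw [e]
  exact AffineSubspace.vadd_mem_of_mem_direction (by rwa [direction_affineSpan])
    (subset_affineSpan ℝ _ (mem_slice_of_mem hx₀))

end Newton

/-! ### Recovering configurations from their slices and compactified slices. -/

section NewtonFaces

open Module

variable {d : ℕ} {A : Finset (EuclideanSpace ℝ (Fin d))} {ω : A → ℝ}

theorem newtonConfig_cases {p : LiftSpace d × ℝ} (hp : p ∈ newtonConfig A ω) :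
    p.2 = 1 ∨ p = (lastBasis d, 0) := by
  rcases hp with rfl | ⟨u, rfl⟩
  · exact Or.inr rfl
  · exact Or.inl rfl

theorem lastBasis_mem_newtonConfig : (lastBasis d, (0 : ℝ)) ∈ newtonConfig A ω :=
  mem_insert _ _

theorem newtonConfig_finite : (newtonConfig A ω).Finite :=
  (finite_range _).insert _

theorem lastBasis_ne_zero : lastBasis d ≠ 0 := fun h => by
  simpa [lastBasis] using congrArg Prod.snd h

theorem zero_notMem_newtonConfig : (0 : LiftSpace d × ℝ) ∉ newtonConfig A ω := fun h => by
  rcases newtonConfig_cases h with h | h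
  · simp at h
  · exact lastBasis_ne_zero (congrArg Prod.fst h).symm

theorem extNewton_eq_slice : extNewton A ω = slice (newtonConfig A ω) := by
  have h1 : {x : LiftSpace d | (x, (1 : ℝ)) ∈ newtonConfig A ω} =
      range fun u : A => ((u : EuclideanSpace ℝ (Fin d)), ω u) := by
    ext x
    simp [newtonConfig]
  have h2 : (lastBasis d, (0 : ℝ)) ∈ newtonConfig A ω := lastBasis_mem_newtonConfig
  rw [extNewton, slice, h1]
  simp [h2]

theorem exists_mem_newtonConfig
    (hA : affineSpan ℝ (A : Set (EuclideanSpace ℝ (Fin d))) = ⊤) :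
    ∃ x, (x, (1 : ℝ)) ∈ newtonConfig A ω := by
  have : (A : Set (EuclideanSpace ℝ (Fin d))).Nonempty := by
    rw [← affineSpan_nonempty ℝ, hA]
    exact ⟨0, trivial⟩
  obtain ⟨u, hu⟩ := this
  exact ⟨_, mem_insert_of_mem _ ⟨⟨u, hu⟩, rfl⟩⟩

/-- A form vanishing on the configuration kills e_{d+1}, so it gives an affine function of `u`
alone; this vanishes on `A`, hence everywhere. -/
theorem span_newtonConfig (hA : affineSpan ℝ (A : Set (EuclideanSpace ℝ (Fin d))) = ⊤) :
    Submodule.span ℝ (newtonConfig A ω) = ⊤ := by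
  by_contra hne
  obtain ⟨f, hf0, hf⟩ := Submodule.exists_le_ker_of_lt_top _ (lt_top_iff_ne_top.2 hne)
  have hf' : ∀ p ∈ newtonConfig A ω, f p = 0 := fun p hp => hf (Submodule.subset_span hp)
  have he : ∀ t : ℝ, f ((0, t), 0) = 0 := fun t => by
    have := congrArg (fun z => t * z) (hf' _ lastBasis_mem_newtonConfig)
    simp only [mul_zero] at this
    rw [← smul_eq_mul, ← map_smul] at this
    simpa [lastBasis] using this
  let φ : EuclideanSpace ℝ (Fin d) →ₗ[ℝ] ℝ :=
    f ∘ₗ LinearMap.inl ℝ _ _ ∘ₗ LinearMap.inl ℝ _ _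
  let ψ : EuclideanSpace ℝ (Fin d) →ᵃ[ℝ] ℝ :=
    φ.toAffineMap + AffineMap.const ℝ _ (f ((0, 0), 1))
  have hψ : ∀ u, ψ u = f ((u, 0), 1) := fun u => by
    simp only [ψ, φ, AffineMap.coe_add, Pi.add_apply, LinearMap.coe_toAffineMap,
      LinearMap.comp_apply, LinearMap.inl_apply, AffineMap.const_apply, ← map_add]
    simp
  have hψ0 : ψ = AffineMap.const ℝ _ 0 := by
    refine AffineMap.ext_on hA fun u hu => ?_
    have := hf' _ (mem_insert_of_mem _ ⟨⟨u, hu⟩, rfl⟩)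
    have h2 := he (ω ⟨u, hu⟩)
    rw [hψ, AffineMap.const_apply]
    calc f ((u, 0), 1) = f ((u, ω ⟨u, hu⟩), 1) - f ((0, ω ⟨u, hu⟩), 0) := by
          rw [← map_sub]; simp
      _ = 0 := by rw [this, h2, sub_zero]
  have hu : ∀ u, f ((u, 0), 1) = 0 := fun u => by rw [← hψ, hψ0, AffineMap.const_apply]
  refine hf0 (LinearMap.ext fun ⟨⟨u, t⟩, s⟩ => ?_)
  calc f ((u, t), s) = f ((u, 0), 1) + f ((0, t), 0) + (s - 1) • f ((0, 0), 1) := by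
        rw [← map_smul, ← map_add, ← map_add]; simp
    _ = 0 := by rw [hu, he, hu]; simp

theorem Cuts.apply_nonneg {S T : Set (LiftSpace d × ℝ)} {f : Dual ℝ (LiftSpace d × ℝ)}
    (hf : Cuts S T f) {x : LiftSpace d} (hx : x ∈ slice S) : 0 ≤ f (x, 1) := by
  obtain ⟨y, hy, t, ht, h, rfl⟩ := mem_slice.1 hx
  have h1 : convexHull ℝ {x | (x, (1 : ℝ)) ∈ S} ⊆ {x | 0 ≤ f (x, 1)} := by
    refine convexHull_min (fun x hx => hf.1 _ hx) ?_
    intro x hx y hy a b ha hb hab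
    rw [mem_ofPred_eq] at hx hy ⊢
    rw [convex_preimage_dual f hab]
    positivity
  rw [apply_mk_one]
  refine add_nonneg (h1 hy) ?_
  rcases h with rfl | h
  · simp
  · exact mul_nonneg ht (hf.1 _ h)

theorem Cuts.mem_slice_iff {S T : Set (LiftSpace d × ℝ)} {f : Dual ℝ (LiftSpace d × ℝ)}
    (hf : Cuts S T f) {x : LiftSpace d} (hx : x ∈ slice S) : x ∈ slice T ↔ f (x, 1) = 0 := by
  refine ⟨fun h => hf.eq_zero_of_mem_span (mem_span_of_mem_slice h), fun h0 => ?_⟩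
  obtain ⟨y, hy, t, ht, h, rfl⟩ := mem_slice.1 hx
  -- The strengthened set is convex: a sum of nonnegative terms with positive weights vanishes only
  -- if each term does.
  have h1 : convexHull ℝ {x | (x, (1 : ℝ)) ∈ S} ⊆
      {x | 0 ≤ f (x, 1) ∧ (f (x, 1) = 0 → x ∈ convexHull ℝ {x | (x, (1 : ℝ)) ∈ T})} := by
    refine convexHull_min (fun x hx => ⟨hf.1 _ hx, fun h =>
      subset_convexHull ℝ _ ((hf.mem_iff hx).2 h)⟩) (convex_iff_forall_pos.2 ?_)
    rintro x ⟨hx, hx'⟩ y ⟨hy, hy'⟩ a b ha hb hab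
    have hax := mul_nonneg ha.le hx
    have hby := mul_nonneg hb.le hy
    rw [mem_ofPred_eq, convex_preimage_dual f hab]
    refine ⟨add_nonneg hax hby, fun h => ?_⟩
    have e1 : a * f (x, 1) = 0 := by linarith
    have e2 : b * f (y, 1) = 0 := by linarith
    exact convex_convexHull ℝ _ (hx' (by simpa [ha.ne'] using e1))
      (hy' (by simpa [hb.ne'] using e2)) ha.le hb.le hab
  rw [apply_mk_one] at h0
  have hy0 := (h1 hy).1
  rcases h with rfl | h
  · exact mem_slice.2 ⟨y, (h1 hy).2 (by simpa using h0), 0, le_rfl, Or.inl rfl, rfl⟩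
  · have := mul_nonneg ht (hf.1 _ h)
    refine mem_slice.2 ⟨y, (h1 hy).2 (by linarith), t, ht, ?_, rfl⟩
    rcases eq_or_ne t 0 with h' | h'
    · exact Or.inl h'
    · refine Or.inr ((hf.mem_iff h).2 ?_)
      have : t * f (lastBasis d, 0) = 0 := by linarith
      simpa [h'] using this

/-- The slice detects the generators at height one, since `T'` consists of all zeros of its form;
the point ∞ detects the ray. -/
theorem compactSlice_subset_iff {T T' : Set (LiftSpace d × ℝ)} (hT : T ⊆ newtonConfig A ω)
    {f : Dual ℝ (LiftSpace d × ℝ)} (hT' : Cuts (newtonConfig A ω) T' f) :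
    compactSlice T ⊆ compactSlice T' ↔ T ⊆ T' := by
  constructor
  · intro h p hp
    rcases newtonConfig_cases (hT hp) with h1 | rfl
    · obtain ⟨x, s⟩ := p
      obtain rfl : s = 1 := h1
      have := h (Or.inl (mem_image_of_mem _ (mem_slice_of_mem hp)))
      rcases this with ⟨y, hy, e⟩ | ⟨e, -⟩
      · obtain rfl : y = x := OnePoint.coe_injective e
        exact (hT'.mem_iff (hT hp)).2 ((hT'.mem_slice_iff (slice_mono hT'.subset hy)).1 hy)
      · exact absurd e (OnePoint.coe_ne_infty _)
    · rcases h (Or.inr ⟨rfl, hp⟩) with ⟨y, hy, e⟩ | ⟨-, h'⟩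
      · exact absurd e (OnePoint.coe_ne_infty _)
      · exact h'
  · rintro h z (⟨x, hx, rfl⟩ | ⟨rfl, hz⟩)
    · exact Or.inl (mem_image_of_mem _ (slice_mono h hx))
    · exact Or.inr ⟨rfl, h hz⟩

/-- Without ∞ the ray is detected by translating a point of the slice by e_{d+1}, hence the need for
a point at height one. -/
theorem slice_subset_iff {T T' : Set (LiftSpace d × ℝ)} (hT : T ⊆ newtonConfig A ω)
    (hne : ∃ x, (x, (1 : ℝ)) ∈ T) {f : Dual ℝ (LiftSpace d × ℝ)}
    (hT' : Cuts (newtonConfig A ω) T' f) : slice T ⊆ slice T' ↔ T ⊆ T' := by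
  refine ⟨fun h => (compactSlice_subset_iff hT hT').1 ?_, slice_mono⟩
  obtain ⟨x, hx⟩ := hne
  rintro z (⟨y, hy, rfl⟩ | ⟨rfl, hz⟩)
  · exact Or.inl (mem_image_of_mem _ (h hy))
  · refine Or.inr ⟨rfl, (hT'.mem_iff (hT hz)).2 ?_⟩
    have h1 := h (mem_slice_of_mem hx)
    have h2 := h (add_smul_mem_slice hz (mem_slice_of_mem hx) zero_le_one)
    have h3 := (hT'.mem_slice_iff (slice_mono hT'.subset h1)).1 h1
    have h4 := (hT'.mem_slice_iff (slice_mono hT'.subset h2)).1 h2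
    rw [apply_mk_one, h3] at h4
    linarith

theorem eq_singleton_of_forall_notMem {T : Set (LiftSpace d × ℝ)}
    (hT : T ⊆ newtonConfig A ω) (hne : T.Nonempty) (h : ¬∃ x, (x, (1 : ℝ)) ∈ T) :
    T = {(lastBasis d, (0 : ℝ))} := by
  refine (hne.subset_singleton_iff).1 fun p hp => ?_
  rcases newtonConfig_cases (hT hp) with h1 | h1
  · exact absurd ⟨p.1, by rwa [← h1]⟩ h
  · exact h1

/-- If `T` is the ray alone, its slice is empty and both sides are 0; this matches the convention
for the vertex ∞. -/
theorem compactDim_compactSlice {T : Set (LiftSpace d × ℝ)} (hT : T ⊆ newtonConfig A ω)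
    (hne : T.Nonempty) : compactDim (compactSlice T) = coneDim T := by
  have hpre : (fun x : LiftSpace d => (x : OnePoint (LiftSpace d))) ⁻¹' compactSlice T =
      slice T := by
    ext x
    simp [compactSlice]
  rw [compactDim, hpre, coneDim]
  by_cases h : ∃ x, (x, (1 : ℝ)) ∈ T
  · obtain ⟨x, hx⟩ := h
    rw [finrank_eq_polyDim_slice_add_one (fun p hp => newtonConfig_cases (hT hp)) hx]
    rfl
  · have hs : slice T = ∅ := by
      rw [← not_nonempty_iff_eq_empty, slice_nonempty_iff]; exact h
    have hT' := eq_singleton_of_forall_notMem hT hne h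
    have hne' : (lastBasis d, (0 : ℝ)) ≠ 0 := fun h => lastBasis_ne_zero (congrArg Prod.fst h)
    rw [hs, hT', Set.finrank, finrank_span_singleton hne']
    simp [polyDim]

theorem slice_eq_convexHull {T : Set (LiftSpace d × ℝ)} (he : (lastBasis d, (0 : ℝ)) ∉ T) :
    slice T = convexHull ℝ {x | (x, (1 : ℝ)) ∈ T} := by
  ext x
  rw [mem_slice]
  constructor
  · rintro ⟨y, hy, t, -, h, rfl⟩
    simpa [h.resolve_right he] using hy
  · intro h
    exact ⟨x, h, 0, le_rfl, Or.inl rfl, by simp⟩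

theorem isCompact_convexHull_slice {T : Set (LiftSpace d × ℝ)} (hT : T.Finite) :
    IsCompact (convexHull ℝ {x : LiftSpace d | (x, (1 : ℝ)) ∈ T}) :=
  (hT.preimage fun _ _ _ _ h => congrArg Prod.fst h).isCompact_convexHull ℝ

theorem isClosed_slice {T : Set (LiftSpace d × ℝ)} (hT : T.Finite) : IsClosed (slice T) := by
  have h2 := isCompact_convexHull_slice hT
  by_cases he : (lastBasis d, (0 : ℝ)) ∈ T
  · refine IsClosed.add_left_of_isCompact ?_ h2
    have : {x | ∃ t : ℝ, 0 ≤ t ∧ x = t • lastBasis d ∧ (t = 0 ∨ (lastBasis d, (0 : ℝ)) ∈ T)} =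
        {x : LiftSpace d | x.1 = 0 ∧ 0 ≤ x.2} := by
      ext ⟨x, s⟩
      simp only [he, or_true, and_true]
      simp [lastBasis, and_comm]
    rw [this]
    exact (isClosed_singleton.preimage continuous_fst).inter
      (isClosed_Ici.preimage continuous_snd)
  · rw [slice_eq_convexHull he]
    exact h2.isClosed

theorem compactifyFace_slice {T : Set (LiftSpace d × ℝ)} (hT : T.Finite)
    (hne : ∃ x, (x, (1 : ℝ)) ∈ T) : compactifyFace (slice T) = compactSlice T := by
  have hcl := isClosed_slice hT
  obtain ⟨x, hx⟩ := hne
  rw [compactifyFace]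
  by_cases he : (lastBasis d, (0 : ℝ)) ∈ T
  · have hinf : OnePoint.infty ∈
        closure ((fun x : LiftSpace d => (x : OnePoint (LiftSpace d))) '' slice T) := by
      by_contra hcon
      -- A closed set missing ∞ is compact, but the slice contains points of arbitrarily large last
      -- coordinate.
      obtain ⟨-, hK⟩ := (OnePoint.isClosed_iff_of_notMem hcon).1 isClosed_closure
      obtain ⟨M, hM⟩ := (hK.image continuous_snd).bddAbove
      have hmem : x + (|M - x.2| + 1) • lastBasis d ∈ slice T :=
        add_smul_mem_slice he (mem_slice_of_mem hx) (by positivity)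
      have := hM (mem_image_of_mem _ (subset_closure (mem_image_of_mem _ hmem)))
      simp [lastBasis] at this
      linarith [le_abs_self (M - x.2)]
    refine Subset.antisymm (closure_minimal subset_union_left ?_) (union_subset subset_closure ?_)
    · rw [OnePoint.isClosed_iff_of_mem (Or.inr ⟨rfl, he⟩)]
      convert hcl
      ext y
      simp [compactSlice]
    · rintro _ ⟨rfl, -⟩
      exact hinf
  · have : compactSlice T = (fun x : LiftSpace d => (x : OnePoint (LiftSpace d))) '' slice T := by
      simp [compactSlice, he]
    rw [this]
    refine IsClosed.closure_eq (OnePoint.isClosed_image_coe.2 ⟨hcl, ?_⟩)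
    rw [slice_eq_convexHull he]
    exact isCompact_convexHull_slice hT

end NewtonFaces

/-! ### The boundary complex and the regular subdivision as images of cone cells. -/

section NewtonComplexes

open Module

variable {d : ℕ} {A : Finset (EuclideanSpace ℝ (Fin d))} {ω : A → ℝ}

/-- The outward normal of the halfspace `{x | 0 ≤ f (x, 1)}`. -/
noncomputable def outwardNormal (f : Dual ℝ (LiftSpace d × ℝ)) : LiftSpace d →L[ℝ] ℝ :=
  LinearMap.toContinuousLinearMap (-(f ∘ₗ LinearMap.inl ℝ (LiftSpace d) ℝ))

theorem outwardNormal_apply (f : Dual ℝ (LiftSpace d × ℝ)) (x : LiftSpace d) :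
    outwardNormal f x = -f (x, 0) := rfl

theorem apply_mk_one_eq (f : Dual ℝ (LiftSpace d × ℝ)) (x : LiftSpace d) :
    f (x, 1) = f (0, 1) - outwardNormal f x := by
  rw [outwardNormal_apply, sub_neg_eq_add, ← map_add]
  simp

theorem slice_eq_toExposed {S T : Set (LiftSpace d × ℝ)} {f : Dual ℝ (LiftSpace d × ℝ)}
    (hf : Cuts S T f) (hT : ∃ x, (x, (1 : ℝ)) ∈ T) :
    slice T = (outwardNormal f).toExposed (slice S) := by
  obtain ⟨x₀, hx₀⟩ := hT
  ext x
  constructor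
  · intro hx
    have hxS := slice_mono hf.subset hx
    refine ⟨hxS, fun y hy => ?_⟩
    have h1 := (hf.mem_slice_iff hxS).1 hx
    have h2 := hf.apply_nonneg hy
    rw [apply_mk_one_eq] at h1 h2
    linarith
  · rintro ⟨hxS, hx⟩
    refine (hf.mem_slice_iff hxS).2 (le_antisymm ?_ (hf.apply_nonneg hxS))
    have h1 := hx x₀ (mem_slice_of_mem (hf.subset hx₀))
    have h2 := hf.eq_zero hx₀
    rw [apply_mk_one_eq] at h2 ⊢
    linarith

/-- The form (x, s) ↦ h(x₀) s - h(x) works: it is nonnegative at height one by maximality of x₀, and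
on the ray because x₀ + e_{d+1} also lies in the polyhedron. -/
theorem exists_cuts_of_mem_toExposed {h : LiftSpace d →L[ℝ] ℝ} {x₀ : LiftSpace d}
    (hx₀ : x₀ ∈ h.toExposed (extNewton A ω)) :
    ∃ T f, Cuts (newtonConfig A ω) T f ∧ (∃ x, (x, (1 : ℝ)) ∈ T) ∧ outwardNormal f = h ∧
      h.toExposed (extNewton A ω) = slice T := by
  rw [extNewton_eq_slice] at hx₀ ⊢
  let f : Dual ℝ (LiftSpace d × ℝ) :=
    h x₀ • LinearMap.snd ℝ _ _ - (h : LiftSpace d →ₗ[ℝ] ℝ) ∘ₗ LinearMap.fst ℝ _ _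
  have hf : ∀ x s, f (x, s) = h x₀ * s - h x := fun x s => rfl
  have hcut : Cuts (newtonConfig A ω) {s ∈ newtonConfig A ω | f s = 0} f := by
    refine ⟨fun p hp => ?_, rfl⟩
    rcases newtonConfig_cases hp with h1 | rfl
    · obtain ⟨x, s⟩ := p
      obtain rfl : s = 1 := h1
      have := hx₀.2 x (mem_slice_of_mem hp)
      rw [hf]
      linarith
    · have := hx₀.2 _ (add_smul_mem_slice hp hx₀.1 zero_le_one)
      rw [map_add, one_smul] at this
      rw [hf]
      linarith
  have hnormal : outwardNormal f = h := by
    ext x <;> simp [outwardNormal_apply, hf]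
  have hne : ∃ x, (x, (1 : ℝ)) ∈ {s ∈ newtonConfig A ω | f s = 0} := by
    rw [← slice_nonempty_iff]
    exact ⟨x₀, (hcut.mem_slice_iff hx₀.1).2 (by rw [hf]; ring)⟩
  refine ⟨_, f, hcut, hne, hnormal, ?_⟩
  rw [slice_eq_toExposed hcut hne, hnormal]

/-- A form with zero normal is constant at height one and vanishes at a point of `T`, hence on all
generators. So `h ≠ 0` in `properFaces` corresponds to properness of `T`. -/
theorem outwardNormal_eq_zero_iff
    (hA : affineSpan ℝ (A : Set (EuclideanSpace ℝ (Fin d))) = ⊤) {T : Set (LiftSpace d × ℝ)}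
    {f : Dual ℝ (LiftSpace d × ℝ)} (hf : Cuts (newtonConfig A ω) T f)
    (hT : ∃ x, (x, (1 : ℝ)) ∈ T) : outwardNormal f = 0 ↔ T = newtonConfig A ω := by
  constructor
  · intro h
    refine hf.subset.antisymm fun p hp => (hf.mem_iff hp).2 ?_
    obtain ⟨x₀, hx₀⟩ := hT
    have h0 : ∀ x, f (x, 0) = 0 := fun x => by
      have := outwardNormal_apply f x
      rw [h] at this
      simpa using this
    rcases newtonConfig_cases hp with h1 | rfl
    · obtain ⟨x, s⟩ := p
      obtain rfl : s = 1 := h1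
      have h2 := hf.eq_zero hx₀
      rw [apply_mk_one_eq, h] at h2 ⊢
      simpa using h2
    · exact h0 _
  · rintro rfl
    ext x <;>
    · simp only [ContinuousLinearMap.comp_apply, outwardNormal_apply]
      rw [hf.eq_zero_of_mem_span (by rw [span_newtonConfig hA]; trivial)]
      simp

/-- The faces of the extended Newton polyhedron are the slices of the faces of its cone. -/
theorem properFaces_extNewton (hA : affineSpan ℝ (A : Set (EuclideanSpace ℝ (Fin d))) = ⊤) :
    properFaces (extNewton A ω) =
      slice '' {T ∈ coneCells (newtonConfig A ω) | ∃ x, (x, (1 : ℝ)) ∈ T} := by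
  ext F
  constructor
  · rintro ⟨⟨x, hx⟩, h, hh, rfl⟩
    obtain ⟨T, f, hf, hT, rfl, e⟩ := exists_cuts_of_mem_toExposed hx
    refine ⟨T, ⟨⟨?_, ?_, f, hf⟩, hT⟩, e.symm⟩
    · obtain ⟨x, hx⟩ := hT; exact ⟨_, hx⟩
    · exact fun h' => hh ((outwardNormal_eq_zero_iff hA hf hT).2 h')
  · rintro ⟨T, ⟨⟨-, h2, f, hf⟩, hT⟩, rfl⟩
    refine ⟨slice_nonempty_iff.2 hT, outwardNormal f, ?_, ?_⟩
    · rwa [Ne, outwardNormal_eq_zero_iff hA hf hT]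
    · rw [extNewton_eq_slice, slice_eq_toExposed hf hT]

theorem exists_one_mem_of_lastBasis_notMem {T : Set (LiftSpace d × ℝ)}
    (hT : T ⊆ newtonConfig A ω) (hne : T.Nonempty) (he : (lastBasis d, (0 : ℝ)) ∉ T) :
    ∃ x, (x, (1 : ℝ)) ∈ T := by
  obtain ⟨p, hp⟩ := hne
  rcases newtonConfig_cases (hT hp) with h | rfl
  · exact ⟨p.1, by rwa [← h]⟩
  · exact absurd hp he

/-- The outward normal takes the value -f(e_{d+1}, 0) at e_{d+1}, which is negative exactly when the
ray is not in `T`. -/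
theorem isLowerFace_extNewton_iff {F : Set (LiftSpace d)} :
    IsLowerFace (extNewton A ω) F ↔
      ∃ T ∈ coneCells (newtonConfig A ω), (lastBasis d, (0 : ℝ)) ∉ T ∧ F = slice T := by
  constructor
  · rintro ⟨⟨x, hx⟩, h, hh, rfl⟩
    obtain ⟨T, f, hf, hT, rfl, e⟩ := exists_cuts_of_mem_toExposed hx
    have he : (lastBasis d, (0 : ℝ)) ∉ T := fun h' => by
      rw [outwardNormal_apply, hf.eq_zero h'] at hh
      simp at hh
    refine ⟨T, ⟨?_, fun h' => he (h' ▸ lastBasis_mem_newtonConfig), f, hf⟩, he, e⟩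
    obtain ⟨x, hx⟩ := hT
    exact ⟨_, hx⟩
  · rintro ⟨T, ⟨h1, -, f, hf⟩, he, rfl⟩
    have hT := exists_one_mem_of_lastBasis_notMem hf.subset h1 he
    refine ⟨slice_nonempty_iff.2 hT, outwardNormal f, ?_, ?_⟩
    · rw [outwardNormal_apply, neg_lt_zero]
      exact hf.pos lastBasis_mem_newtonConfig he
    · rw [extNewton_eq_slice, slice_eq_toExposed hf hT]

theorem slice_injOn : InjOn slice {T | (∃ f, Cuts (newtonConfig A ω) T f) ∧
    ∃ x, (x, (1 : ℝ)) ∈ T} := by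
  rintro T ⟨⟨f, hf⟩, hT⟩ T' ⟨⟨f', hf'⟩, hT'⟩ e
  exact ((slice_subset_iff hf.subset hT hf').1 e.subset).antisymm
    ((slice_subset_iff hf'.subset hT' hf).1 e.symm.subset)

theorem isLowerFace_slice_iff {T : Set (LiftSpace d × ℝ)}
    (hT : T ∈ coneCells (newtonConfig A ω)) (hne : ∃ x, (x, (1 : ℝ)) ∈ T) :
    IsLowerFace (extNewton A ω) (slice T) ↔ (lastBasis d, (0 : ℝ)) ∉ T := by
  rw [isLowerFace_extNewton_iff]
  refine ⟨?_, fun h => ⟨T, hT, h, rfl⟩⟩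
  rintro ⟨T', hT', h, e⟩
  obtain ⟨f', hf'⟩ := hT'.2.2
  rwa [slice_injOn ⟨hT.2.2, hne⟩
    ⟨⟨f', hf'⟩, exists_one_mem_of_lastBasis_notMem hf'.subset hT'.1 h⟩ e]

/-- The condition on `x` discards the ray alone, which is a facet of the cone when d = 0 but no face
of the polyhedron. -/
theorem facets_extNewton (hA : affineSpan ℝ (A : Set (EuclideanSpace ℝ (Fin d))) = ⊤) :
    facets (extNewton A ω) =
      slice '' {T | IsConeFacet (newtonConfig A ω) T ∧ ∃ x, (x, (1 : ℝ)) ∈ T} := by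
  have hφ : ∀ σ ∈ {T ∈ coneCells (newtonConfig A ω) | ∃ x, (x, (1 : ℝ)) ∈ T},
      ∀ τ ∈ {T ∈ coneCells (newtonConfig A ω) | ∃ x, (x, (1 : ℝ)) ∈ T},
      slice σ ⊆ slice τ ↔ σ ⊆ τ := by
    rintro σ ⟨⟨-, -, f, hf⟩, hσ⟩ τ ⟨⟨-, -, g, hg⟩, -⟩
    exact slice_subset_iff hf.subset hσ hg
  ext F
  rw [facets, properFaces_extNewton hA]
  constructor
  · intro h
    obtain ⟨T, hT, rfl⟩ := h.1
    obtain ⟨-, hmax⟩ := (mem_maximalCells_image hφ hT).1 h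
    obtain ⟨⟨-, h2, f, hf⟩, x, hx⟩ := hT
    obtain ⟨G, hG, hTG⟩ := exists_facet_superset newtonConfig_finite hf h2
    have := hmax (y := G) ⟨hG.mem_coneCells ⟨_, hTG hx⟩, x, hTG hx⟩ hTG
    rw [this.antisymm hTG] at hG
    exact ⟨T, ⟨hG, x, hx⟩, rfl⟩
  · rintro ⟨T, ⟨hT, x, hx⟩, rfl⟩
    have hTK := hT.mem_coneCells ⟨_, hx⟩
    refine (mem_maximalCells_image hφ ⟨hTK, x, hx⟩).2 ⟨⟨hTK, x, hx⟩, ?_⟩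
    rintro T' ⟨⟨-, h2, f, hf⟩, -⟩ hTT'
    exact (hT.eq_of_subset hf h2 hTT').subset

/-- A cell without points at height one is the ray alone and becomes {∞}. Requiring a larger cell
with such points mirrors the condition that ∞ lie on a proper face. -/
theorem compactBoundary_extNewton
    (hA : affineSpan ℝ (A : Set (EuclideanSpace ℝ (Fin d))) = ⊤) :
    compactBoundary (extNewton A ω) =
      compactSlice '' {T ∈ coneCells (newtonConfig A ω) |
        ∃ F ∈ coneCells (newtonConfig A ω), (∃ x, (x, (1 : ℝ)) ∈ F) ∧ T ⊆ F} := by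
  have hfin : ∀ T ∈ coneCells (newtonConfig A ω), T.Finite := fun T ⟨_, _, f, hf⟩ =>
    newtonConfig_finite.subset hf.subset
  have hinf : compactSlice {(lastBasis d, (0 : ℝ))} = {OnePoint.infty} := by
    have : slice {(lastBasis d, (0 : ℝ))} = ∅ := by
      rw [← not_nonempty_iff_eq_empty, slice_nonempty_iff]
      simp
    rw [compactSlice, this]
    simp
  rw [compactBoundary, properFaces_extNewton hA]
  ext σ
  constructor
  · rintro (⟨_, ⟨T, ⟨hT, hx⟩, rfl⟩, rfl⟩ | ⟨rfl, _, ⟨T, ⟨hT, hx⟩, rfl⟩, hinfty⟩)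
    · rw [compactifyFace_slice (hfin T hT) hx]
      exact mem_image_of_mem _ ⟨hT, T, hT, hx, Subset.rfl⟩
    · rw [compactifyFace_slice (hfin T hT) hx] at hinfty
      rcases hinfty with ⟨y, -, e⟩ | ⟨-, he⟩
      · exact absurd e (OnePoint.coe_ne_infty _)
      -- The height coordinate cuts out the ray: it is 1 on all other generators.
      refine ⟨{(lastBasis d, 0)}, ⟨⟨singleton_nonempty _, ?_, LinearMap.snd ℝ _ _, ?_⟩, T, hT, hx,
        singleton_subset_iff.2 he⟩, hinf⟩
      · intro h
        obtain ⟨x, hx⟩ := exists_mem_newtonConfig (ω := ω) hA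
        rw [← h] at hx
        simp at hx
      · refine ⟨fun p hp => ?_, ?_⟩
        · rcases newtonConfig_cases hp with h | rfl
          · simp [h]
          · simp
        · ext p
          constructor
          · rintro rfl
            exact ⟨lastBasis_mem_newtonConfig, rfl⟩
          · rintro ⟨hp, h0⟩
            rcases newtonConfig_cases hp with h | h
            · simp [h] at h0
            · exact h
  · rintro ⟨T, ⟨hT, F, hF, hFx, hTF⟩, rfl⟩
    by_cases hTx : ∃ x, (x, (1 : ℝ)) ∈ T
    · refine Or.inl ⟨_, mem_image_of_mem _ ⟨hT, hTx⟩, ?_⟩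
      rw [compactifyFace_slice (hfin T hT) hTx]
    · obtain ⟨f, hf⟩ := hT.2.2
      obtain rfl := eq_singleton_of_forall_notMem hf.subset hT.1 hTx
      refine Or.inr ⟨hinf, slice F, mem_image_of_mem _ ⟨hF, hFx⟩, ?_⟩
      rw [compactifyFace_slice (hfin F hF) hFx]
      exact Or.inr ⟨rfl, hTF rfl⟩

/-- The lower faces of the cone over the extended Newton polyhedron. -/
def lowerCells (A : Finset (EuclideanSpace ℝ (Fin d))) (ω : A → ℝ) :
    Set (Set (LiftSpace d × ℝ)) :=
  {T ∈ coneCells (newtonConfig A ω) | (lastBasis d, (0 : ℝ)) ∉ T}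

theorem regularSubdivision_eq :
    regularSubdivision A ω = (fun T => projectCell (slice T)) '' lowerCells A ω := by
  rw [regularSubdivision]
  ext C
  constructor
  · rintro ⟨F, hF, rfl⟩
    obtain ⟨T, hT, he, rfl⟩ := isLowerFace_extNewton_iff.1 hF
    exact ⟨T, ⟨hT, he⟩, rfl⟩
  · rintro ⟨T, ⟨hT, he⟩, rfl⟩
    exact ⟨slice T, isLowerFace_extNewton_iff.2 ⟨T, hT, he, rfl⟩, rfl⟩

theorem exists_one_mem_of_mem_lowerCells {T : Set (LiftSpace d × ℝ)} (hT : T ∈ lowerCells A ω) :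
    ∃ x, (x, (1 : ℝ)) ∈ T := by
  obtain ⟨f, hf⟩ := hT.1.2.2
  exact exists_one_mem_of_lastBasis_notMem hf.subset hT.1.1 hT.2

/-- Two points of lower faces over the same base point coincide: each form is nonnegative on the
polyhedron, zero on its own face and positive on e_{d+1}, so neither point can lie above the other.
-/
theorem projectCell_subset_iff {T T' : Set (LiftSpace d × ℝ)} (hT : T ∈ lowerCells A ω)
    (hT' : T' ∈ lowerCells A ω) :
    projectCell (slice T) ⊆ projectCell (slice T') ↔ T ⊆ T' := by
  obtain ⟨f, hf⟩ := hT.1.2.2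
  obtain ⟨g, hg⟩ := hT'.1.2.2
  refine ⟨fun h => ?_, fun h => image_mono (slice_mono h)⟩
  refine (slice_subset_iff hf.subset (exists_one_mem_of_mem_lowerCells hT) hg).1 fun x hx => ?_
  have hxS := slice_mono hf.subset hx
  obtain ⟨y, hy, e⟩ := h (mem_image_of_mem _ hx)
  have hyS := slice_mono hg.subset hy
  have hxy : x = y + (x.2 - y.2) • lastBasis d := by
    ext <;> simp [lastBasis, e]
  have hyx : y = x + (y.2 - x.2) • lastBasis d := by
    ext <;> simp [lastBasis, e]
  have h1 := hf.apply_nonneg hyS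
  have h2 := hg.apply_nonneg hxS
  have h3 := hf.pos lastBasis_mem_newtonConfig hT.2
  have h4 := hg.pos lastBasis_mem_newtonConfig hT'.2
  rw [hyx, apply_mk_one, (hf.mem_slice_iff hxS).1 hx, zero_add] at h1
  rw [hxy, apply_mk_one, (hg.mem_slice_iff hyS).1 hy, zero_add] at h2
  have h5 := nonneg_of_mul_nonneg_left h1 h3
  have h6 := nonneg_of_mul_nonneg_left h2 h4
  have : x.2 - y.2 = 0 := by linarith
  rw [hxy, this]
  simpa using hy

/-- The form of a lower face is positive on e_{d+1} and zero on the directions of the face, so these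
contain no nonzero vertical vector and project injectively. -/
theorem polyDim_projectCell {T : Set (LiftSpace d × ℝ)} (hT : T ∈ lowerCells A ω) :
    polyDim (projectCell (slice T)) = coneDim T := by
  obtain ⟨f, hf⟩ := hT.1.2.2
  obtain ⟨x₀, hx₀⟩ := exists_one_mem_of_mem_lowerCells hT
  have hspan := span_eq_sup (fun p hp => newtonConfig_cases (hf.subset hp)) hx₀
  rw [coneDim, finrank_eq_polyDim_slice_add_one
    (fun p hp => newtonConfig_cases (hf.subset hp)) hx₀, Nat.add_sub_cancel, polyDim, polyDim]
  have : projectCell (slice T) =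
      (LinearMap.fst ℝ (EuclideanSpace ℝ (Fin d)) ℝ).toAffineMap '' slice T := rfl
  rw [this, ← AffineMap.map_vectorSpan, LinearMap.toAffineMap_linear]
  refine finrank_map_of_forall_eq_zero _ _ fun w hw hw0 => ?_
  have hfw : f (w, 0) = 0 := hf.eq_zero_of_mem_span (by
    rw [hspan]
    exact Submodule.mem_sup_right ⟨w, hw, rfl⟩)
  have hwe : w = w.2 • lastBasis d := by
    ext
    · simp [lastBasis, show w.1 = 0 from hw0]
    · simp [lastBasis]
  have h3 := hf.pos lastBasis_mem_newtonConfig hT.2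
  have h4 : (w, (0 : ℝ)) = w.2 • (lastBasis d, (0 : ℝ)) := by
    rw [Prod.smul_mk, ← hwe, smul_zero]
  rw [h4, map_smul, smul_eq_mul] at hfw
  rw [hwe, (mul_eq_zero.1 hfw).resolve_right h3.ne', zero_smul]

end NewtonComplexes

/-! ### Lines, their crossings with facet hyperplanes, and the induced facet order. -/

section Lines

open Module

variable {d : ℕ} {A : Finset (EuclideanSpace ℝ (Fin d))} {ω : A → ℝ}

/-- The line through `o` with direction `v` meets the hyperplane of `f` at `o + a⁻¹ v`, where `a`
is this number. -/
noncomputable def crossing (f : Dual ℝ (LiftSpace d × ℝ)) (o v : LiftSpace d) : ℝ :=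
  f (-(v, 0)) / f (o, 1)

theorem mem_affineSpan_slice_iff (hA : affineSpan ℝ (A : Set (EuclideanSpace ℝ (Fin d))) = ⊤)
    {T : Set (LiftSpace d × ℝ)} (hT : IsConeFacet (newtonConfig A ω) T)
    (hne : ∃ x, (x, (1 : ℝ)) ∈ T) {f : Dual ℝ (LiftSpace d × ℝ)}
    (hf : Cuts (newtonConfig A ω) T f) {x : LiftSpace d} :
    x ∈ affineSpan ℝ (slice T) ↔ f (x, 1) = 0 := by
  obtain ⟨x₀, hx₀⟩ := hne
  have hcases : ∀ p ∈ T, p.2 = 1 ∨ p = (lastBasis d, 0) := fun p hp =>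
    newtonConfig_cases (hf.subset hp)
  constructor
  · intro hx
    have h1 := AffineSubspace.vsub_mem_direction hx
      (subset_affineSpan ℝ _ (mem_slice_of_mem hx₀))
    rw [direction_affineSpan] at h1
    have h2 : f (x - x₀, 0) = 0 := hf.eq_zero_of_mem_span (by
      rw [span_eq_sup hcases hx₀]
      exact Submodule.mem_sup_right ⟨_, h1, rfl⟩)
    have h3 := apply_mk_one f x₀ (x - x₀) 1
    rw [one_smul, add_sub_cancel, h2, hf.eq_zero hx₀] at h3
    simpa using h3
  · intro hx
    refine mem_affineSpan_slice hcases hx₀ (hT.mem_span hf ?_ hx)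
    rw [span_newtonConfig hA]
    trivial

theorem meetsAt_slice_iff (hA : affineSpan ℝ (A : Set (EuclideanSpace ℝ (Fin d))) = ⊤)
    {T : Set (LiftSpace d × ℝ)} (hT : IsConeFacet (newtonConfig A ω) T)
    (hne : ∃ x, (x, (1 : ℝ)) ∈ T) {f : Dual ℝ (LiftSpace d × ℝ)}
    (hf : Cuts (newtonConfig A ω) T f) {o v p : LiftSpace d} (ho : 0 < f (o, 1)) :
    MeetsAt o v (slice T) p ↔ crossing f o v ≠ 0 ∧ p = o + (crossing f o v)⁻¹ • v := by
  have hneg : f (-(v, 0)) = -f (v, 0) := map_neg _ _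
  have hmem : ∀ x, x ∈ lineThrough o v ∩ (affineSpan ℝ (slice T) : Set (LiftSpace d)) ↔
      ∃ t : ℝ, f (o, 1) + t * f (v, 0) = 0 ∧ x = o + t • v := by
    intro x
    constructor
    · rintro ⟨⟨t, rfl⟩, hx⟩
      rw [SetLike.mem_coe, mem_affineSpan_slice_iff hA hT hne hf, apply_mk_one] at hx
      exact ⟨t, hx, rfl⟩
    · rintro ⟨t, ht, rfl⟩
      refine ⟨⟨t, rfl⟩, ?_⟩
      rwa [SetLike.mem_coe, mem_affineSpan_slice_iff hA hT hne hf, apply_mk_one]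
  have hsol : ∀ t : ℝ, f (o, 1) + t * f (v, 0) = 0 ↔
      crossing f o v ≠ 0 ∧ t = (crossing f o v)⁻¹ := by
    intro t
    rw [crossing, hneg, inv_div]
    constructor
    · intro h
      have hv : f (v, 0) ≠ 0 := fun h' => by
        rw [h', mul_zero, add_zero] at h
        exact ho.ne' h
      refine ⟨div_ne_zero (neg_ne_zero.2 hv) ho.ne', ?_⟩
      rw [eq_div_iff (neg_ne_zero.2 hv)]
      linarith
    · rintro ⟨h, rfl⟩
      have hv : f (v, 0) ≠ 0 := fun h' => h (by rw [h']; simp)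
      field_simp
      ring
  rw [MeetsAt]
  constructor
  · intro h
    obtain ⟨t, ht, rfl⟩ := (hmem p).1 (h ▸ rfl)
    obtain ⟨h1, rfl⟩ := (hsol t).1 ht
    exact ⟨h1, rfl⟩
  · rintro ⟨h1, rfl⟩
    ext x
    rw [hmem, mem_singleton_iff]
    constructor
    · rintro ⟨t, ht, rfl⟩
      rw [((hsol t).1 ht).2]
    · rintro rfl
      exact ⟨_, (hsol _).2 ⟨h1, rfl⟩, rfl⟩

/-- Stepping from `o` slightly away from a generator with positive value, or slightly downwards if
that generator is the ray, stays in the polyhedron, where the form is nonnegative. Its value at `o`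
must therefore be positive. -/
theorem Cuts.pos_of_mem_interior {T : Set (LiftSpace d × ℝ)} {f : Dual ℝ (LiftSpace d × ℝ)}
    (hf : Cuts (newtonConfig A ω) T f) (hT : T ≠ newtonConfig A ω) {o : LiftSpace d}
    (ho : o ∈ interior (extNewton A ω)) : 0 < f (o, 1) := by
  have hray : ∀ w : LiftSpace d, ∃ δ : ℝ, 0 < δ ∧ 0 ≤ f (o, 1) + δ * f (w, 0) := by
    intro w
    have hcont : Tendsto (fun δ : ℝ => o + δ • w) (𝓝[>] 0) (𝓝 o) := by
      have : Continuous fun δ : ℝ => o + δ • w := by fun_prop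
      simpa using (this.tendsto 0).mono_left (nhdsWithin_le_nhds (s := Ioi 0))
    obtain ⟨δ, h1, h2⟩ := ((hcont.eventually (mem_interior_iff_mem_nhds.1 ho)).and
      self_mem_nhdsWithin).exists
    refine ⟨δ, h2, ?_⟩
    rw [← apply_mk_one]
    exact hf.apply_nonneg (by rw [← extNewton_eq_slice]; exact h1)
  obtain ⟨s, hs, hfs⟩ := hf.exists_ne hT
  rcases newtonConfig_cases hs with h1 | rfl
  · obtain ⟨x, s⟩ := s
    obtain rfl : s = 1 := h1
    obtain ⟨δ, hδ, h⟩ := hray (o - x)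
    have e : f (o - x, 0) = f (o, 1) - f (x, 1) := by rw [← map_sub]; simp
    rw [e] at h
    nlinarith [mul_pos hδ hfs]
  · obtain ⟨δ, hδ, h⟩ := hray (-lastBasis d)
    have e : f (-lastBasis d, 0) = -f (lastBasis d, 0) := by rw [← map_neg]; simp
    rw [e] at h
    nlinarith [mul_pos hδ hfs]

/-- The line parameter is the inverse of the crossing. As the crossing increases through negative
and then positive values, the parameter falls from 0 to -∞ and then from +∞ to 0. -/
theorem precedes_of_lt {F G : Set (LiftSpace d)} {o v : LiftSpace d} (hv : 0 < v.2) {a b : ℝ}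
    (hF : MeetsAt o v F (o + a⁻¹ • v)) (hG : MeetsAt o v G (o + b⁻¹ • v)) (ha : a ≠ 0)
    (hb : b ≠ 0) (hab : a < b) : Precedes o v F G := by
  refine ⟨_, _, hF, hG, ?_⟩
  simp only [Prod.snd_add, Prod.smul_snd, smul_eq_mul]
  rcases lt_or_gt_of_ne ha with ha' | ha' <;> rcases lt_or_gt_of_ne hb with hb' | hb'
  · have h1 := (inv_lt_inv_of_neg hb' ha').2 hab
    have h2 := inv_lt_zero.2 ha'
    exact Or.inr (Or.inl ⟨by nlinarith, by nlinarith⟩)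
  · have h1 := inv_lt_zero.2 ha'
    have h2 := inv_pos.2 hb'
    exact Or.inl ⟨by nlinarith, by nlinarith⟩
  · linarith
  · have h1 := (inv_lt_inv₀ hb' ha').2 hab
    have h2 := inv_pos.2 hb'
    exact Or.inr (Or.inr ⟨by nlinarith, by nlinarith⟩)

/-- A face omits the ray exactly when its form is negative at -e_{d+1}, so `exists_facet` places it
in a facet with the same property. -/
theorem coneSubcomplex_eq_lowerCells {l : List (Set (LiftSpace d × ℝ))}
    (hl : ∀ T, T ∈ l ↔ (IsConeFacet (newtonConfig A ω) T ∧ T.Nonempty) ∧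
      (lastBasis d, (0 : ℝ)) ∉ T) :
    coneSubcomplex (newtonConfig A ω) l = lowerCells A ω := by
  ext T
  constructor
  · rintro ⟨hT, F, hF, hTF⟩
    exact ⟨hT, fun h => ((hl F).1 hF).2 (hTF h)⟩
  · rintro ⟨hT, he⟩
    obtain ⟨f, hf⟩ := hT.2.2
    obtain ⟨G, g, hg, hG, hTG, hge⟩ := exists_facet newtonConfig_finite
      (Submodule.neg_mem _ (Submodule.subset_span lastBasis_mem_newtonConfig)) hf
      (by rw [map_neg, neg_lt_zero]; exact hf.pos lastBasis_mem_newtonConfig he)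
    refine ⟨hT, G, (hl G).2 ⟨⟨hG, hT.1.mono hTG⟩, fun h => ?_⟩, hTG⟩
    rw [map_neg, hg.eq_zero h] at hge
    simp at hge

theorem isConeFacet_of_mem_maximalCells_lowerCells {T : Set (LiftSpace d × ℝ)}
    (hT : T ∈ maximalCells (lowerCells A ω)) : IsConeFacet (newtonConfig A ω) T := by
  have hfin : {T | (IsConeFacet (newtonConfig A ω) T ∧ T.Nonempty) ∧
      (lastBasis d, (0 : ℝ)) ∉ T}.Finite :=
    (finite_facets newtonConfig_finite).subset fun T h => h.1.1
  have hl := coneSubcomplex_eq_lowerCells (A := A) (ω := ω) (l := hfin.toFinset.toList)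
    (by simp)
  rw [← hl, ← maximalCells_coneSubcomplex (by simp +contextual)] at hT
  simp only [Finset.mem_toList, Finite.mem_toFinset, mem_ofPred_eq] at hT
  exact hT.1.1

/-- The order of the facets along a line which is close to a vertical line. -/
theorem exists_facet_order (hA : affineSpan ℝ (A : Set (EuclideanSpace ℝ (Fin d))) = ⊤)
    {c : Set (LiftSpace d × ℝ) → Dual ℝ (LiftSpace d × ℝ)}
    (hc : ∀ T, IsConeFacet (newtonConfig A ω) T → Cuts (newtonConfig A ω) T (c T))
    {o v : LiftSpace d} (ho : o ∈ interior (extNewton A ω)) (hv : 0 < v.2)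
    (hsep : ∀ T, IsConeFacet (newtonConfig A ω) T → ∀ T', IsConeFacet (newtonConfig A ω) T' →
      (lastBasis d, (0 : ℝ)) ∉ T → (lastBasis d, (0 : ℝ)) ∈ T' →
      crossing (c T) o v < crossing (c T') o v)
    (hgen : IsGenericLine (extNewton A ω) o v) :
    ∃ low rest : List (Set (LiftSpace d × ℝ)),
      (∀ T, T ∈ low ↔ (IsConeFacet (newtonConfig A ω) T ∧ T.Nonempty) ∧
        (lastBasis d, (0 : ℝ)) ∉ T) ∧
      low.Pairwise (fun T T' => crossing (c T) o v < crossing (c T') o v) ∧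
      IsLineOrder (extNewton A ω) o v (low.map slice ++ rest.map slice) ∧
      (∀ F ∈ low.map slice, IsLowerFace (extNewton A ω) F) ∧
      (∀ F ∈ rest.map slice, ¬ IsLowerFace (extNewton A ω) F) ∧
      IsShelling compactDim (compactBoundary (extNewton A ω))
        ((low.map slice ++ rest.map slice).map compactifyFace) ∧
      IsShelling polyDim (regularSubdivision A ω) ((low.map slice).map projectCell) := by
  set S := newtonConfig A ω
  have hfin := finite_facets (newtonConfig_finite (A := A) (ω := ω))
  have hpos : ∀ T, IsConeFacet S T → 0 < c T (o, 1) := fun T hT =>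
    (hc T hT).pos_of_mem_interior hT.ne ho
  have hmeet : ∀ T, IsConeFacet S T → (∃ x, (x, (1 : ℝ)) ∈ T) → crossing (c T) o v ≠ 0 ∧
      MeetsAt o v (slice T) (o + (crossing (c T) o v)⁻¹ • v) := by
    intro T hT hx
    obtain ⟨p, hp⟩ := hgen.1 (slice T) (by rw [facets_extNewton hA]; exact ⟨T, ⟨hT, hx⟩, rfl⟩)
    have h := (meetsAt_slice_iff hA hT hx (hc T hT) (hpos T hT)).1 hp
    exact ⟨h.1, by rwa [← h.2]⟩
  have hinj : InjOn (fun T => crossing (c T) o v)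
      {T | IsConeFacet S T ∧ ∃ x, (x, (1 : ℝ)) ∈ T} := by
    rintro T ⟨hT, hTx⟩ T' ⟨hT', hTx'⟩ e
    by_contra hne
    refine hgen.2 (slice T) (by rw [facets_extNewton hA]; exact ⟨T, ⟨hT, hTx⟩, rfl⟩)
      (slice T') (by rw [facets_extNewton hA]; exact ⟨T', ⟨hT', hTx'⟩, rfl⟩)
      (fun h => hne (slice_injOn ⟨hT.1, hTx⟩ ⟨hT'.1, hTx'⟩ h)) _ _ (hmeet T hT hTx).2
      (hmeet T' hT' hTx').2 ?_
    have e' : crossing (c T) o v = crossing (c T') o v := e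
    rw [e']
  have hlow_subset : {T | (IsConeFacet S T ∧ T.Nonempty) ∧ (lastBasis d, (0 : ℝ)) ∉ T} ⊆
      {T | IsConeFacet S T ∧ ∃ x, (x, (1 : ℝ)) ∈ T} := fun T hT =>
    ⟨hT.1.1, exists_one_mem_of_lastBasis_notMem hT.1.1.subset hT.1.2 hT.2⟩
  obtain ⟨low, hlow, hlow'⟩ := exists_sorted_list
    (s := {T | (IsConeFacet S T ∧ T.Nonempty) ∧ (lastBasis d, (0 : ℝ)) ∉ T})
    (hfin.subset fun T hT => hT.1.1) (fun T => crossing (c T) o v)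
    (hinj.mono hlow_subset)
  obtain ⟨rest, hrest, hrest'⟩ := exists_sorted_list
    (s := {T | (IsConeFacet S T ∧ ∃ x, (x, (1 : ℝ)) ∈ T) ∧ (lastBasis d, (0 : ℝ)) ∈ T})
    (hfin.subset fun T hT => hT.1.1) (fun T => crossing (c T) o v)
    (hinj.mono fun T hT => hT.1)
  have hlone : ∀ T, IsConeFacet S T → T.Nonempty → (¬∃ x, (x, (1 : ℝ)) ∈ T) →
      T = {(lastBasis d, (0 : ℝ))} := fun T hT hne hx =>
    eq_singleton_of_forall_notMem hT.subset hne hx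
  -- This list has at most one entry, the ray alone. The sweep of the cone needs it, but it is no
  -- facet of the polyhedron, so it is put at the end and the shelling is taken on the initial
  -- segment before it.
  obtain ⟨last, hlast, hlast'⟩ := exists_sorted_list
    (s := {T | (IsConeFacet S T ∧ T.Nonempty) ∧ ¬∃ x, (x, (1 : ℝ)) ∈ T})
    (hfin.subset fun T hT => hT.1.1) (fun T => crossing (c T) o v) (by
      rintro T ⟨⟨hT, h1⟩, h2⟩ T' ⟨⟨hT', h1'⟩, h2'⟩ -
      rw [hlone T hT h1 h2, hlone T' hT' h1' h2'])
  simp only [mem_ofPred_eq] at hlow hrest hlast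
  have hlowx : ∀ T ∈ low, ∃ x, (x, (1 : ℝ)) ∈ T := fun T hT =>
    exists_one_mem_of_lastBasis_notMem ((hlow T).1 hT).1.1.subset ((hlow T).1 hT).1.2
      ((hlow T).1 hT).2
  have hmem : ∀ T, T ∈ low ++ rest ↔ IsConeFacet S T ∧ ∃ x, (x, (1 : ℝ)) ∈ T := by
    intro T
    rw [List.mem_append]
    constructor
    · rintro (h | h)
      · exact ⟨((hlow T).1 h).1.1, hlowx T h⟩
      · exact ((hrest T).1 h).1
    · rintro ⟨hT, x, hx⟩
      by_cases he : (lastBasis d, (0 : ℝ)) ∈ T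
      · exact Or.inr ((hrest T).2 ⟨⟨hT, x, hx⟩, he⟩)
      · exact Or.inl ((hlow T).2 ⟨⟨hT, _, hx⟩, he⟩)
  have hsorted : (low ++ rest).Pairwise
      (fun T T' => crossing (c T) o v < crossing (c T') o v) :=
    List.pairwise_append.2 ⟨hlow', hrest', fun T hT T' hT' =>
      hsep T ((hlow T).1 hT).1.1 T' ((hrest T').1 hT').1.1 ((hlow T).1 hT).2
        ((hrest T').1 hT').2⟩
  have hsweep : SweepOrder S c (o, 1) (-(v, 0)) ((low ++ rest) ++ last) := by
    refine ⟨hc, ?_, ?_, hpos, fun T => ?_, List.pairwise_append.2 ⟨hsorted, hlast', ?_⟩⟩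
    · rw [span_newtonConfig hA]; trivial
    · rw [span_newtonConfig hA]; trivial
    · rw [List.mem_append, hmem, hlast]
      constructor
      · rintro (⟨h, x, hx⟩ | h)
        · exact ⟨h, _, hx⟩
        · exact h.1
      · intro h
        by_cases hx : ∃ x, (x, (1 : ℝ)) ∈ T
        · exact Or.inl ⟨h.1, hx⟩
        · exact Or.inr ⟨h, hx⟩
    · intro T hT T' hT'
      obtain ⟨⟨h1, h2⟩, h3⟩ := (hlast T').1 hT'
      have he := hlone T' h1 h2 h3
      rcases List.mem_append.1 hT with hT | hT
      · exact hsep T ((hlow T).1 hT).1.1 T' h1 ((hlow T).1 hT).2 (by rw [he]; rfl)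
      -- A facet containing the ray cannot coexist with the ray as a facet of its own, so `rest` and
      -- `last` are never both nonempty.
      · obtain ⟨⟨h4, h5⟩, h6⟩ := (hrest T).1 hT
        have := h1.eq_of_subset_facet h4 (by rw [he]; exact singleton_subset_iff.2 h6)
        exact absurd h5 (this ▸ h3)
  have hcuts : ∀ T ∈ coneCells S, ∃ f, Cuts S T f := fun T hT => hT.2.2
  refine ⟨low, rest, hlow, hlow', ⟨fun F => ?_, ?_⟩, ?_, ?_, ?_, ?_⟩
  · rw [← List.map_append, List.mem_map, facets_extNewton hA]
    exact exists_congr fun T => and_congr_left fun _ => hmem T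
  · rw [← List.map_append, List.pairwise_map]
    refine hsorted.imp_of_mem fun {T T'} hT hT' hlt => ?_
    obtain ⟨h1, h2⟩ := (hmem T).1 hT
    obtain ⟨h1', h2'⟩ := (hmem T').1 hT'
    exact precedes_of_lt hv (hmeet T h1 h2).2 (hmeet T' h1' h2').2 (hmeet T h1 h2).1
      (hmeet T' h1' h2').1 hlt
  · intro F hF
    obtain ⟨T, hT, rfl⟩ := List.mem_map.1 hF
    obtain ⟨⟨h1, h2⟩, h3⟩ := (hlow T).1 hT
    exact (isLowerFace_slice_iff (h1.mem_coneCells h2) (hlowx T hT)).2 h3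
  · intro F hF
    obtain ⟨T, hT, rfl⟩ := List.mem_map.1 hF
    obtain ⟨⟨h1, x, hx⟩, h3⟩ := (hrest T).1 hT
    rw [isLowerFace_slice_iff (h1.mem_coneCells ⟨_, hx⟩) ⟨x, hx⟩]
    exact not_not_intro h3
  · have h := (hsweep.isShelling newtonConfig_finite zero_notMem_newtonConfig).map
      (φ := compactSlice) (dim' := compactDim) (fun T hT T' hT' => by
        obtain ⟨f, hf⟩ := hcuts T hT.1
        obtain ⟨f', hf'⟩ := hcuts T' hT'.1
        exact compactSlice_subset_iff hf.subset hf') (fun T hT => by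
        obtain ⟨f, hf⟩ := hcuts T hT.1
        exact compactDim_compactSlice hf.subset hT.1.1)
    have e1 : (low.map slice ++ rest.map slice).map compactifyFace =
        (low ++ rest).map compactSlice := by
      rw [← List.map_append, List.map_map]
      refine List.map_congr_left fun T hT => ?_
      obtain ⟨h1, h2⟩ := (hmem T).1 hT
      exact compactifyFace_slice (newtonConfig_finite.subset h1.subset) h2
    have e2 : compactBoundary (extNewton A ω) =
        compactSlice '' coneSubcomplex S (low ++ rest) := by
      rw [compactBoundary_extNewton hA]
      congr 1
      ext T
      refine and_congr_right fun hT => ⟨?_, ?_⟩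
      · rintro ⟨F, ⟨-, h2, f, hf⟩, ⟨x, hx⟩, hTF⟩
        obtain ⟨G, hG, hFG⟩ := exists_facet_superset newtonConfig_finite hf h2
        exact ⟨G, (hmem G).2 ⟨hG, x, hFG hx⟩, hTF.trans hFG⟩
      · rintro ⟨F, hF, hTF⟩
        obtain ⟨h1, x, hx⟩ := (hmem F).1 hF
        exact ⟨F, h1.mem_coneCells ⟨_, hx⟩, ⟨x, hx⟩, hTF⟩
    rw [e1, e2]
    exact h
  -- Regrouping makes `low` the initial segment; its subcomplex consists of all lower cells.
  · rw [List.append_assoc] at hsweep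
    have h := hsweep.isShelling newtonConfig_finite zero_notMem_newtonConfig
    rw [coneSubcomplex_eq_lowerCells hlow] at h
    rw [regularSubdivision_eq, List.map_map]
    exact h.map (fun T hT T' hT' => projectCell_subset_iff hT hT')
      (fun T hT => polyDim_projectCell hT)

end Lines

/-! ### Existence of generic lines, stability near vertical lines, choice of the first facet. -/

section Generic

open Module

variable {d : ℕ} {A : Finset (EuclideanSpace ℝ (Fin d))} {ω : A → ℝ}

/-- For fixed `o`, it suffices for genericity that finitely many linear forms in `v` do not vanish:
one per facet against parallelism, one per pair of facets against equal crossings. None of these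
forms is zero. -/
theorem frequently_isGenericLine (hA : affineSpan ℝ (A : Set (EuclideanSpace ℝ (Fin d))) = ⊤)
    {o : LiftSpace d} (ho : o ∈ interior (extNewton A ω)) (p : LiftSpace d) :
    ∃ᶠ v in 𝓝 p, IsGenericLine (extNewton A ω) o v := by
  classical
  set S := newtonConfig A ω
  obtain ⟨c, hc⟩ := exists_cuts S
  have hpos : ∀ T, IsConeFacet S T → 0 < c T (o, 1) := fun T hT =>
    (hc T hT).pos_of_mem_interior hT.ne ho
  let I : Set (Set (LiftSpace d × ℝ)) := {T | IsConeFacet S T ∧ ∃ x, (x, (1 : ℝ)) ∈ T}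
  have hI : I.Finite := (finite_facets newtonConfig_finite).subset fun T hT => hT.1
  have : Finite I := hI
  let ι := I ⊕ {P : I × I // P.1 ≠ P.2}
  let ℓ : ι → Dual ℝ (LiftSpace d) := fun i => (Sum.elim (fun T : I => c T)
    (fun P : {P : I × I // P.1 ≠ P.2} => c P.1.1 (o, 1) • c P.1.2 - c P.1.2 (o, 1) • c P.1.1) i) ∘ₗ
      LinearMap.inl ℝ (LiftSpace d) ℝ
  have hℓ : ∀ i, ∃ x, ℓ i x ≠ 0 := by
    rintro (⟨T, hT⟩ | ⟨⟨⟨T, hT⟩, ⟨T', hT'⟩⟩, hne⟩)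
    · by_contra! h
      refine hT.1.ne ((outwardNormal_eq_zero_iff hA (hc T hT.1) hT.2).1 ?_)
      refine ContinuousLinearMap.ext fun x => ?_
      rw [outwardNormal_apply, zero_apply, neg_eq_zero]
      exact h x
    · by_contra! h
      -- The relation holds at height zero by assumption and trivially at (o, 1), hence everywhere.
      -- The two forms would be proportional and cut out the same facet.
      have h0 : ∀ q : LiftSpace d × ℝ, c T (o, 1) * c T' q = c T' (o, 1) * c T q := by
        rintro ⟨x, s⟩
        have h1 : c T (o, 1) * c T' (x - s • o, 0) - c T' (o, 1) * c T (x - s • o, 0) = 0 :=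
          h (x - s • o)
        have h2 : (x, s) = (x - s • o, (0 : ℝ)) + s • (o, (1 : ℝ)) := by simp
        rw [h2, map_add, map_add, map_smul, map_smul, smul_eq_mul, smul_eq_mul]
        linarith
      have hsub : T ⊆ T' := fun s hs => by
        have h1 := h0 s
        rw [(hc T hT.1).eq_zero hs, mul_zero] at h1
        exact ((hc T' hT'.1).mem_iff (hT.1.subset hs)).2
          ((mul_eq_zero.1 h1).resolve_left (hpos T hT.1).ne')
      exact hne (Subtype.ext (hT.1.eq_of_subset_facet hT'.1 hsub).symm)
  obtain ⟨w, hw⟩ := Module.Dual.exists_forall_ne_zero_of_forall_exists ℓ hℓ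
  have hcont : Tendsto (fun ε : ℝ => p + ε • w) (𝓝[>] 0) (𝓝 p) := by
    have : Continuous fun ε : ℝ => p + ε • w := by fun_prop
    simpa using (this.tendsto 0).mono_left (nhdsWithin_le_nhds (s := Ioi 0))
  refine hcont.frequently (Eventually.frequently ?_)
  filter_upwards [eventually_forall_apply_add_smul_ne_zero ℓ hw p] with ε hε
  set v := p + ε • w
  have hcross : ∀ T ∈ I, crossing (c T) o v ≠ 0 := fun T hT => by
    have h1 : c T (v, 0) ≠ 0 := hε (Sum.inl ⟨T, hT⟩)
    refine div_ne_zero ?_ (hpos T hT.1).ne'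
    rw [map_neg]
    exact neg_ne_zero.2 h1
  have hmeet : ∀ T ∈ I, ∀ p, MeetsAt o v (slice T) p ↔
      crossing (c T) o v ≠ 0 ∧ p = o + (crossing (c T) o v)⁻¹ • v := fun T hT p =>
    meetsAt_slice_iff hA hT.1 hT.2 (hc T hT.1) (hpos T hT.1)
  rw [IsGenericLine, facets_extNewton hA]
  refine ⟨?_, ?_⟩
  · rintro _ ⟨T, hT, rfl⟩
    exact ⟨_, (hmeet T hT _).2 ⟨hcross T hT, rfl⟩⟩
  · rintro _ ⟨T, hT, rfl⟩ _ ⟨T', hT', rfl⟩ hne q q' hq hq' e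
    have hq := ((hmeet T hT q).1 hq).2
    have hq' := ((hmeet T' hT' q').1 hq').2
    have hTT' : T ≠ T' := fun h => hne (by rw [h])
    have h1 : ℓ (Sum.inl ⟨T, hT⟩) v ≠ 0 := hε _
    have hv : v ≠ 0 := fun h => h1 (by rw [h, map_zero])
    have h2 : c T (o, 1) * c T' (v, 0) - c T' (o, 1) * c T (v, 0) ≠ 0 :=
      hε (Sum.inr ⟨⟨⟨T, hT⟩, ⟨T', hT'⟩⟩, fun h => hTT' (congrArg Subtype.val h)⟩)
    rw [hq, hq', add_right_inj] at e
    have h3 := inv_injective (smul_left_injective ℝ hv e)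
    rw [crossing, crossing, div_eq_div_iff (hpos T hT.1).ne' (hpos T' hT'.1).ne', map_neg,
      map_neg] at h3
    exact h2 (by linarith)

theorem tendsto_crossing (f : Dual ℝ (LiftSpace d × ℝ)) {o v : LiftSpace d}
    (ho : f (o, 1) ≠ 0) :
    Tendsto (fun L : LiftSpace d × LiftSpace d => crossing f L.1 L.2) (𝓝 (o, v))
      (𝓝 (crossing f o v)) := by
  have hf := f.continuous_of_finiteDimensional
  have h1 : Continuous fun L : LiftSpace d × LiftSpace d => f (-(L.2, (0 : ℝ))) :=
    hf.comp (by fun_prop)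
  have h2 : Continuous fun L : LiftSpace d × LiftSpace d => f (L.1, (1 : ℝ)) :=
    hf.comp (by fun_prop)
  exact (h1.tendsto (o, v)).div (h2.tendsto (o, v)) ho

/-- The conclusion of `exists_facet_order` holds for all generic lines close to a vertical one. -/
theorem eventually_facet_order_hypotheses
    {c : Set (LiftSpace d × ℝ) → Dual ℝ (LiftSpace d × ℝ)}
    (hc : ∀ T, IsConeFacet (newtonConfig A ω) T → Cuts (newtonConfig A ω) T (c T))
    {o : LiftSpace d} (ho : o ∈ interior (extNewton A ω)) :
    ∀ᶠ L in 𝓝 (o, lastBasis d), L.1 ∈ interior (extNewton A ω) ∧ 0 < L.2.2 ∧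
      ∀ T, IsConeFacet (newtonConfig A ω) T → ∀ T', IsConeFacet (newtonConfig A ω) T' →
      (lastBasis d, (0 : ℝ)) ∉ T → (lastBasis d, (0 : ℝ)) ∈ T' →
      crossing (c T) L.1 L.2 < crossing (c T') L.1 L.2 := by
  have hfin := finite_facets (newtonConfig_finite (A := A) (ω := ω))
  refine Eventually.and ?_ (Eventually.and ?_ ?_)
  · exact continuous_fst.continuousAt.eventually (isOpen_interior.mem_nhds ho)
  · have h : Continuous fun L : LiftSpace d × LiftSpace d => L.2.2 := by fun_prop
    exact (h.tendsto (o, lastBasis d)).eventually_const_lt (by simp [lastBasis])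
  · refine (hfin.eventually_all).2 fun T hT => (hfin.eventually_all).2 fun T' hT' => ?_
    by_cases he : (lastBasis d, (0 : ℝ)) ∉ T ∧ (lastBasis d, (0 : ℝ)) ∈ T'
    · have hpos : ∀ T, IsConeFacet (newtonConfig A ω) T → 0 < c T (o, 1) := fun T hT =>
        (hc T hT).pos_of_mem_interior hT.ne ho
      have h1 := tendsto_crossing (c T) (v := lastBasis d) (hpos T hT).ne'
      have h2 := tendsto_crossing (c T') (v := lastBasis d) (hpos T' hT').ne'
      -- For the vertical direction the crossing is negative if the ray is not in the facet and zero
      -- if it is; continuity extends the strict inequality to nearby lines.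
      have hlt : crossing (c T) o (lastBasis d) < crossing (c T') o (lastBasis d) := by
        rw [crossing, crossing, map_neg, map_neg, (hc T' hT').eq_zero he.2, neg_zero, zero_div]
        exact div_neg_of_neg_of_pos
          (neg_lt_zero.2 ((hc T hT).pos lastBasis_mem_newtonConfig he.1)) (hpos T hT)
      filter_upwards [h1.eventually_lt h2 hlt] with L hL _ _ using hL
    · exact Eventually.of_forall fun L h h' => absurd ⟨h, h'⟩ he

theorem convex_extNewton : Convex ℝ (extNewton A ω) := by
  refine (convex_convexHull ℝ _).add ?_
  rintro _ ⟨s, hs, rfl⟩ _ ⟨t, ht, rfl⟩ a b ha hb -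
  exact ⟨a * s + b * t, by positivity, by rw [add_smul, mul_smul, mul_smul]⟩

theorem interior_extNewton_nonempty
    (hA : affineSpan ℝ (A : Set (EuclideanSpace ℝ (Fin d))) = ⊤) :
    (interior (extNewton A ω)).Nonempty := by
  rw [convex_extNewton.interior_nonempty_iff_affineSpan_eq_top, extNewton_eq_slice, eq_top_iff]
  intro x _
  obtain ⟨x₀, hx₀⟩ := exists_mem_newtonConfig (ω := ω) hA
  refine mem_affineSpan_slice (fun p hp => newtonConfig_cases hp) hx₀ ?_
  rw [span_newtonConfig hA]
  trivial

/-- A bounded face has a point which lies in no facet other than those which contain the face. -/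
theorem exists_mem_slice_pos {T : Set (LiftSpace d × ℝ)} (hT : T ⊆ newtonConfig A ω)
    (hne : T.Nonempty) (he : (lastBasis d, (0 : ℝ)) ∉ T) :
    ∃ q ∈ slice T, ∀ G g, Cuts (newtonConfig A ω) G g → ¬ T ⊆ G → 0 < g (q, 1) := by
  have hfin : T.Finite := newtonConfig_finite.subset hT
  have hone : ∀ p ∈ T, p = (p.1, 1) := fun p hp => by
    rcases newtonConfig_cases (hT hp) with h | rfl
    · rw [← h]
    · exact absurd hp he
  -- The point is the barycentre of the generators of `T`: a form that is positive at one of them is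
  -- positive there.
  set n : ℝ := (hfin.toFinset.card : ℝ)
  have hn : 0 < n := by
    simp only [n, Nat.cast_pos, Finset.card_pos]
    simpa using hne
  have hQ : (∑ p ∈ hfin.toFinset, n⁻¹ • p.1, (1 : ℝ)) = ∑ p ∈ hfin.toFinset, n⁻¹ • p := by
    ext1
    · simp [Prod.fst_sum]
    · rw [Prod.snd_sum, Finset.sum_congr rfl (g := fun _ => n⁻¹) fun p hp => by
        rw [hone p (hfin.mem_toFinset.1 hp)]; simp]
      simp [n, hn.ne']
  refine ⟨∑ p ∈ hfin.toFinset, n⁻¹ • p.1, ?_, fun G g hg hTG => ?_⟩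
  · rw [slice_eq_convexHull he]
    refine (convex_convexHull ℝ _).sum_mem (fun _ _ => (inv_pos.2 hn).le) (by simp [n, hn.ne'])
      fun p hp => subset_convexHull ℝ _ ?_
    have hp' := hfin.mem_toFinset.1 hp
    rw [mem_ofPred_eq, ← hone p hp']
    exact hp'
  · obtain ⟨s, hs, hsG⟩ := not_subset.1 hTG
    rw [hQ, map_sum]
    refine Finset.sum_pos' (fun p hp => ?_) ⟨s, hfin.mem_toFinset.2 hs, ?_⟩
    · rw [map_smul, smul_eq_mul]
      exact mul_nonneg (inv_pos.2 hn).le (hg.1 p (hT (hfin.mem_toFinset.1 hp)))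
    · rw [map_smul, smul_eq_mul]
      exact mul_pos (inv_pos.2 hn) (hg.pos (hT hs) hsG)

/-- Starting close to a lower facet, a vertical line crosses this facet first. -/
theorem exists_mem_interior_crossing_lt
    (hA : affineSpan ℝ (A : Set (EuclideanSpace ℝ (Fin d))) = ⊤)
    {c : Set (LiftSpace d × ℝ) → Dual ℝ (LiftSpace d × ℝ)}
    (hc : ∀ T, IsConeFacet (newtonConfig A ω) T → Cuts (newtonConfig A ω) T (c T))
    {T : Set (LiftSpace d × ℝ)} (hT : IsConeFacet (newtonConfig A ω) T) (hne : T.Nonempty)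
    (he : (lastBasis d, (0 : ℝ)) ∉ T) :
    ∃ o ∈ interior (extNewton A ω), ∀ G, IsConeFacet (newtonConfig A ω) G → G ≠ T →
      crossing (c T) o (lastBasis d) < crossing (c G) o (lastBasis d) := by
  obtain ⟨z, hz⟩ := interior_extNewton_nonempty (ω := ω) hA
  obtain ⟨q, hq, hqpos⟩ := exists_mem_slice_pos hT.subset hne he
  have hqU : q ∈ extNewton A ω := by
    rw [extNewton_eq_slice]
    exact slice_mono hT.subset hq
  have hcT := hc T hT
  have hTe := hcT.pos lastBasis_mem_newtonConfig he
  have hTq : c T (q, 1) = 0 := hcT.eq_zero_of_mem_span (mem_span_of_mem_slice hq)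
  have hfin := finite_facets (newtonConfig_finite (A := A) (ω := ω))
  -- This is the desired inequality with denominators cleared, for o = (1 - ε) q + ε z and c_T(q) =
  -- 0. At ε = 0 it reads 0 < c_T(e_{d+1}) c_G(q).
  have hev : ∀ᶠ ε : ℝ in 𝓝[>] 0, ∀ G ∈ {G | IsConeFacet (newtonConfig A ω) G}, G ≠ T →
      ε * c T (z, 1) * c G (lastBasis d, 0) <
        c T (lastBasis d, 0) * ((1 - ε) * c G (q, 1) + ε * c G (z, 1)) := by
    refine (hfin.eventually_all).2 fun G hG => ?_
    by_cases hGT : G = T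
    · exact Eventually.of_forall fun _ h => absurd hGT h
    · have h1 : Continuous fun ε : ℝ => ε * c T (z, 1) * c G (lastBasis d, 0) := by fun_prop
      have h2 : Continuous fun ε : ℝ =>
          c T (lastBasis d, 0) * ((1 - ε) * c G (q, 1) + ε * c G (z, 1)) := by fun_prop
      have hGq := hqpos G _ (hc G hG) fun h => hGT (hT.eq_of_subset_facet hG h)
      have := (h1.tendsto 0).eventually_lt (h2.tendsto 0) (by simpa using mul_pos hTe hGq)
      filter_upwards [nhdsWithin_le_nhds this] with ε hε _ using hε
  have hlt : ∀ᶠ ε : ℝ in 𝓝[>] 0, ε < 1 :=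
    nhdsWithin_le_nhds (eventually_lt_nhds zero_lt_one)
  have hgt : ∀ᶠ ε : ℝ in 𝓝[>] 0, 0 < ε := self_mem_nhdsWithin
  obtain ⟨ε, hε, hε0, hε1⟩ := (hev.and (hgt.and hlt)).exists
  have ho : (1 - ε) • q + ε • z ∈ interior (extNewton A ω) :=
    convex_extNewton.combo_self_interior_mem_interior hqU hz (by linarith) hε0 (by ring)
  refine ⟨_, ho, fun G hG hGT => ?_⟩
  have h1 := hcT.pos_of_mem_interior hT.ne ho
  have h2 := (hc G hG).pos_of_mem_interior hG.ne ho
  have h3 := hε G hG hGT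
  rw [crossing, crossing, map_neg, map_neg, div_lt_div_iff₀ h1 h2]
  rw [convex_preimage_dual _ (by ring)] at h1 h2 ⊢
  rw [convex_preimage_dual _ (by ring), hTq]
  linarith

end Generic

theorem mainTheorem5 {d : ℕ} (A : Finset (EuclideanSpace ℝ (Fin d)))
    (hA : affineSpan ℝ (A : Set (EuclideanSpace ℝ (Fin d))) = ⊤) (ω : A → ℝ) :
    -- generic lines exist arbitrarily close to every vertical line, and all those which are
    -- sufficiently close induce a shelling of the compactified boundary, whose initial part
    -- formed by the lower facets induces a shelling of the regular subdivision
    (∀ o ∈ interior (extNewton A ω),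
      (∃ᶠ v in 𝓝 (lastBasis d), IsGenericLine (extNewton A ω) o v) ∧
      ∀ᶠ L in 𝓝 (o, lastBasis d), IsGenericLine (extNewton A ω) L.1 L.2 →
        ∃ low rest : List (Set (LiftSpace d)),
          IsLineOrder (extNewton A ω) L.1 L.2 (low ++ rest) ∧
          (∀ F ∈ low, IsLowerFace (extNewton A ω) F) ∧
          (∀ F ∈ rest, ¬ IsLowerFace (extNewton A ω) F) ∧
          IsShelling compactDim (compactBoundary (extNewton A ω))
            ((low ++ rest).map compactifyFace) ∧
          IsShelling polyDim (regularSubdivision A ω) (low.map projectCell)) ∧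
    -- the first maximal cell can be picked arbitrarily
    (∀ C ∈ maximalCells (regularSubdivision A ω), ∃ o ∈ interior (extNewton A ω),
      ∀ᶠ L in 𝓝 (o, lastBasis d), IsGenericLine (extNewton A ω) L.1 L.2 →
        ∃ low rest : List (Set (LiftSpace d)),
          IsLineOrder (extNewton A ω) L.1 L.2 (low ++ rest) ∧
          (∀ F ∈ low, IsLowerFace (extNewton A ω) F) ∧
          (∀ F ∈ rest, ¬ IsLowerFace (extNewton A ω) F) ∧
          IsShelling compactDim (compactBoundary (extNewton A ω))
            ((low ++ rest).map compactifyFace) ∧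
          IsShelling polyDim (regularSubdivision A ω) (low.map projectCell) ∧
          (low.map projectCell).head? = some C) := by
  obtain ⟨c, hc⟩ := exists_cuts (newtonConfig A ω)
  refine ⟨fun o ho => ⟨frequently_isGenericLine hA ho _, ?_⟩, fun C hC => ?_⟩
  · filter_upwards [eventually_facet_order_hypotheses hc ho] with L hL hgen
    obtain ⟨h1, h2, h3⟩ := hL
    obtain ⟨low, rest, -, -, h⟩ := exists_facet_order hA hc h1 h2 h3 hgen
    exact ⟨_, _, h⟩
  · rw [regularSubdivision_eq] at hC
    obtain ⟨T, hT, rfl⟩ := hC.1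
    have hTfacet := isConeFacet_of_mem_maximalCells_lowerCells
      ((mem_maximalCells_image (fun T hT T' hT' => projectCell_subset_iff hT hT') hT).1 hC)
    obtain ⟨o, ho, hcross⟩ := exists_mem_interior_crossing_lt hA hc hTfacet hT.1.1 hT.2
    have hfirst : ∀ᶠ L in 𝓝 (o, lastBasis d), ∀ G ∈ {G | IsConeFacet (newtonConfig A ω) G},
        G ≠ T → crossing (c T) L.1 L.2 < crossing (c G) L.1 L.2 := by
      refine ((finite_facets newtonConfig_finite).eventually_all).2 fun G hG => ?_
      by_cases hGT : G = T
      · exact Eventually.of_forall fun _ h => absurd hGT h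
      · have h1 := tendsto_crossing (c T) (v := lastBasis d)
          ((hc T hTfacet).pos_of_mem_interior hTfacet.ne ho).ne'
        have h2 := tendsto_crossing (c G) (v := lastBasis d)
          ((hc G hG).pos_of_mem_interior hG.ne ho).ne'
        filter_upwards [h1.eventually_lt h2 (hcross G hG hGT)] with L hL _ using hL
    refine ⟨o, ho, ?_⟩
    filter_upwards [eventually_facet_order_hypotheses hc ho, hfirst] with L hL hLT hgen
    obtain ⟨h1, h2, h3⟩ := hL
    obtain ⟨low, rest, hlow, hsorted, h4, h5, h6, h7, h8⟩ :=
      exists_facet_order hA hc h1 h2 h3 hgen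
    refine ⟨_, _, h4, h5, h6, h7, h8, ?_⟩
    have hTlow : T ∈ low := (hlow T).2 ⟨⟨hTfacet, hT.1.1⟩, hT.2⟩
    cases low with
    | nil => simp at hTlow
    | cons G low =>
      have hG := ((hlow G).1 (by simp)).1.1
      -- Near the chosen vertical line `T` has the strictly smallest crossing of all facets, so the
      -- sorted list cannot begin with another one.
      have hGT : G = T := by
        by_contra hne
        rcases List.mem_cons.1 hTlow with h | h
        · exact hne h.symm
        · exact lt_asymm (hLT G hG hne) ((List.pairwise_cons.1 hsorted).1 T h)
      simp [hGT]
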